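/- Let $n\ge 1$, $\alpha>0$. For $1\le p<\infty$ let $\mathcal F^p_\alpha$ be the space of entire functions $f$ on $\mathbb C^n$ with $\|f\|_{(p,\alpha)}^p=\left(\frac{\alpha p}{2\pi}\right)^n\int_{\mathbb C^n}|f(z)|^pe^{-\frac{\alpha p}{2}|z|^2}\,dV(z)<\infty$, and let $\mathcal F^\infty_\alpha$ be the space of entire functions with $\|f\|_{(\infty,\alpha)}=\sup_z|f(z)|e^{-\frac{\alpha}{2}|z|^2}<\infty$. Put $K_w(z)=e^{\alpha\langle z,w\rangle}$, where $\langle z,w\rangle=\sum_j z_j\overline{w_j}$. Let $\mu$ be a nonnegative Borel measure on $\mathbb C^n$ that is admissible: $\int|K_w(z)|^2e^{-\alpha|w|^2}\,d\mu(w)<\infty$ for every $z\in\mathbb C^n$. The Toeplitz operator is $$T_\mu f(z)=\int_{\mathbb C^n}K_w(z)f(w)e^{-\alpha|w|^2}\,d\mu(w),$$ with natural domain in $\mathcal F^p_\alpha$ the set of those $f\in\mathcal F^p_\alpha$ for which the integral converges absolutely for every $z$; boundedness, compactness and $\|T_\mu\|$ refer to this domain. For $1\le q<\infty$ put $d\sigma_q(z)=e^{-\frac{q\alpha}{2}|z|^2}d\mu(z)$.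 We call $\mu$ a $(p,q)$ (vanishing) Fock–Carleson measure if the embedding $I_\mu:\mathcal F^p_\alpha\to L^q(\sigma_q)$ is bounded (compact). Operator norms take the value $\infty$ for unbounded operators, and $U\simeq V$ means that $U\le CV$ and $V\le CU$ with a constant $C$ independent of $\mu$ (it may depend on $n,\alpha,p$). (i) Let $1\le p\le\infty$. Then $T_\mu:\mathcal F^1_\alpha\to\mathcal F^p_\alpha$ is bounded (respectively compact) if and only if $\mu$ is a $(1,q)$ Fock–Carleson measure (respectively a $(1,q)$ vanishing Fock–Carleson measure) for some, equivalently for every, finite $q\ge p$ (for $p=\infty$: finite $q\ge1$). Moreover $$\|T_\mu\|\simeq\|I_\mu:\mathcal F^1_\alpha\to L^1(\sigma_1)\|,\qquad\text{and}\qquad \|T_\mu\|\simeq\|I_\mu:\mathcal F^1_\alpha\to L^p(\sigma_p)\|^p\quad\text{if }p<\infty.$$ (ii) Let $1<p\le\infty$. Then $T_\mu:\mathcal F^p_\alpha\to\mathcal F^1_\alpha$ is bounded if and only if it is compact, and if and only if $\mu$ is a $(p,1)$ Fock–Carleson measure. For every $r>0$ and every sequence $(z_j)$ in $\mathbb C^n$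 such that the balls $D(z_j,r/2)$ cover $\mathbb C^n$ and the balls $D(z_j,r/4)$ are mutually disjoint, the latter holds if and only if $(\mu(D(z_j,r)))_j\in\ell^{p/(p-1)}$ (where $p/(p-1)=1$ for $p=\infty$). Moreover $\|T_\mu\|\simeq\|I_\mu:\mathcal F^p_\alpha\to L^1(\sigma_1)\|$. In both parts, if $T_\mu$ is bounded then its natural domain is the whole source space. -/

import Mathlib

open MeasureTheory Filter Topology
open scoped NNReal ENNReal

/-- The complex space `ℂⁿ` with its Hermitian norm; `volume` on it is Lebesgue measure. -/
abbrev Cn (n : ℕ) : Type := EuclideanSpace ℂ (Fin n)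

/-- The reproducing kernel `K_w(z) = exp (α ⟨z, w⟩)` with `⟨z, w⟩ = ∑ z_j conj (w_j)`
(Mathlib's inner product is conjugate linear in its first argument). -/
noncomputable def fockKernel {n : ℕ} (α : ℝ) (w z : Cn n) : ℂ :=
  Complex.exp ((α : ℂ) * inner ℂ w z)

/-- The (possibly infinite) Fock norm `‖f‖_{(p,α)}`, for `0 < p ≤ ∞`. -/
noncomputable def fockNorm {n : ℕ} (α : ℝ) (p : ℝ≥0∞) (f : Cn n → ℂ) : ℝ≥0∞ :=
  if p = ⊤ then ⨆ z : Cn n, ‖f z‖ₑ * ENNReal.ofReal (Real.exp (-(α / 2) * ‖z‖ ^ 2))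
  else (ENNReal.ofReal ((α * p.toReal / (2 * Real.pi)) ^ n) *
    ∫⁻ z : Cn n, ‖f z‖ₑ ^ p.toReal *
      ENNReal.ofReal (Real.exp (-(α * p.toReal / 2) * ‖z‖ ^ 2))) ^ (1 / p.toReal)

/-- Membership in the Fock space `F^p_α`: entire functions of finite norm. -/
def MemFock {n : ℕ} (α : ℝ) (p : ℝ≥0∞) (f : Cn n → ℂ) : Prop :=
  Differentiable ℂ f ∧ fockNorm α p f < ⊤

/-- The admissibility condition `∫ |K_w(z)|² e^{-α|w|²} dμ(w) < ∞` for every `z`. -/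
def Admissible {n : ℕ} (α : ℝ) (μ : Measure (Cn n)) : Prop :=
  ∀ z : Cn n,
    ∫⁻ w, ‖fockKernel α w z‖ₑ ^ 2 * ENNReal.ofReal (Real.exp (-α * ‖w‖ ^ 2)) ∂μ < ⊤

/-- The integrand of the Toeplitz operator at the point `z`. -/
noncomputable def toeplitzIntegrand {n : ℕ} (α : ℝ) (f : Cn n → ℂ) (z w : Cn n) : ℂ :=
  fockKernel α w z * f w * (Real.exp (-α * ‖w‖ ^ 2) : ℂ)

/-- The Toeplitz operator `T_μ f(z) = ∫ K_w(z) f(w) e^{-α|w|²} dμ(w)`. -/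
noncomputable def toeplitz {n : ℕ} (α : ℝ) (μ : Measure (Cn n)) (f : Cn n → ℂ) (z : Cn n) : ℂ :=
  ∫ w, toeplitzIntegrand α f z w ∂μ

/-- The natural domain of `T_μ` in `F^p_α`: those `f` for which the defining integral converges
absolutely at every point. Admissibility puts all finite combinations of kernels into it. -/
def InToeplitzDomain {n : ℕ} (α : ℝ) (μ : Measure (Cn n)) (p : ℝ≥0∞) (f : Cn n → ℂ) : Prop :=
  MemFock α p f ∧ ∀ z : Cn n, Integrable (toeplitzIntegrand α f z) μ

/-- `T_μ : F^p_α → F^s_α` is bounded (as an operator on its natural domain). -/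
def ToeplitzBounded {n : ℕ} (α : ℝ) (μ : Measure (Cn n)) (p s : ℝ≥0∞) : Prop :=
  ∃ C : ℝ≥0, ∀ f : Cn n → ℂ, InToeplitzDomain α μ p f →
    MemFock α s (toeplitz α μ f) ∧ fockNorm α s (toeplitz α μ f) ≤ C * fockNorm α p f

/-- `T_μ : F^p_α → F^s_α` is compact: it is bounded, and the image of every sequence in the unit
ball has a subsequence that converges in the norm of `F^s_α`. -/
def ToeplitzCompact {n : ℕ} (α : ℝ) (μ : Measure (Cn n)) (p s : ℝ≥0∞) : Prop :=
  ToeplitzBounded α μ p s ∧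
    ∀ f : ℕ → Cn n → ℂ, (∀ m, InToeplitzDomain α μ p (f m) ∧ fockNorm α p (f m) ≤ 1) →
      ∃ φ : ℕ → ℕ, StrictMono φ ∧ ∃ g : Cn n → ℂ, MemFock α s g ∧
        Tendsto (fun m => fockNorm α s (fun z => toeplitz α μ (f (φ m)) z - g z)) atTop (𝓝 0)

/-- The operator norm of `T_μ : F^p_α → F^s_α`, infinite if `T_μ` is unbounded. -/
noncomputable def toeplitzNorm {n : ℕ} (α : ℝ) (μ : Measure (Cn n)) (p s : ℝ≥0∞) : ℝ≥0∞ :=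
  ⨆ (f : Cn n → ℂ) (_ : InToeplitzDomain α μ p f) (_ : fockNorm α p f ≤ 1),
    fockNorm α s (toeplitz α μ f)

/-- The measure `dσ_q(z) = e^{-qα|z|²/2} dμ(z)`. -/
noncomputable def sigmaMeasure {n : ℕ} (α : ℝ) (μ : Measure (Cn n)) (q : ℝ) : Measure (Cn n) :=
  μ.withDensity fun z => ENNReal.ofReal (Real.exp (-(q * α / 2) * ‖z‖ ^ 2))

/-- `μ` is a `(p, q)` Fock–Carleson measure (`0 < p ≤ ∞`, `0 < q < ∞`). -/
def IsFockCarleson {n : ℕ} (α : ℝ) (μ : Measure (Cn n)) (p : ℝ≥0∞) (q : ℝ) : Prop :=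
  ∃ C : ℝ≥0, ∀ f : Cn n → ℂ, MemFock α p f →
    ∫⁻ z, ‖f z‖ₑ ^ q * ENNReal.ofReal (Real.exp (-(α * q / 2) * ‖z‖ ^ 2)) ∂μ
      ≤ C * fockNorm α p f ^ q

/-- The norm of the embedding `I_μ : F^p_α → L^q(σ_q)`, infinite if it is unbounded. -/
noncomputable def embeddingNorm {n : ℕ} (α : ℝ) (μ : Measure (Cn n)) (p : ℝ≥0∞) (q : ℝ) :
    ℝ≥0∞ :=
  ⨆ (f : Cn n → ℂ) (_ : MemFock α p f) (_ : fockNorm α p f ≤ 1),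
    eLpNorm f (ENNReal.ofReal q) (sigmaMeasure α μ q)

/-- `μ` is a `(p, q)` vanishing Fock–Carleson measure: the embedding `I_μ : F^p_α → L^q(σ_q)` is
(bounded and) compact, so the image of every sequence in the unit ball has a subsequence that
converges in `L^q(σ_q)`. -/
def IsVanishingFockCarleson {n : ℕ} (α : ℝ) (μ : Measure (Cn n)) (p : ℝ≥0∞) (q : ℝ) : Prop :=
  IsFockCarleson α μ p q ∧
    ∀ f : ℕ → Cn n → ℂ, (∀ m, MemFock α p (f m) ∧ fockNorm α p (f m) ≤ 1) →
      ∃ φ : ℕ → ℕ, StrictMono φ ∧ ∃ g : Cn n → ℂ,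
        MemLp g (ENNReal.ofReal q) (sigmaMeasure α μ q) ∧
        Tendsto (fun m => eLpNorm (fun z => f (φ m) z - g z) (ENNReal.ofReal q)
          (sigmaMeasure α μ q)) atTop (𝓝 0)

/-- `z` is an `r/2`-lattice in `ℂⁿ`: the balls `D(z_k, r/2)` cover, and the balls `D(z_k, r/4)` are
mutually disjoint. -/
def IsHalfLattice {n : ℕ} (r : ℝ) (z : ℕ → Cn n) : Prop :=
  (⋃ k, Metric.ball (z k) (r / 2)) = Set.univ ∧
    Pairwise fun j k => Disjoint (Metric.ball (z j) (r / 4)) (Metric.ball (z k) (r / 4))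

/-- The exponents `q` in "finite `q ≥ p`"; for `p = ∞`, all finite `q ≥ 1`. -/
def CarlesonExponent (p : ℝ≥0∞) (q : ℝ) : Prop :=
  1 ≤ q ∧ (p ≠ ⊤ → p ≤ ENNReal.ofReal q)

/-- `U ≃ V` on the class of admissible measures, with one constant for all of them. -/
def AdmissibleEquiv {n : ℕ} (α : ℝ) (U V : Measure (Cn n) → ℝ≥0∞) : Prop :=
  ∃ C : ℝ≥0, ∀ μ : Measure (Cn n), Admissible α μ → U μ ≤ C * V μ ∧ V μ ≤ C * U μ

-- Two facts carry everything. For entire $f$ the weighted modulus $|f|e^{-\alpha|\cdot|^2/2}$ at a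
-- point is at most a constant times its integral over a ball about that point, with the same
-- constant everywhere (`exists_enorm_weighted_le_lintegral_ball`). The normalized kernel $k_a$ has
-- weighted modulus exactly $e^{-\alpha|z-a|^2/2}$, so it is a unit vector of every Fock space and a
-- bump at $a$.
--
-- Upper bounds for $T_\mu$ come from Tonelli: integrating the kernel in $z$ gives $\|T_\mu
-- f\|_{(1,\alpha)}\le C\int|f|e^{-\alpha|w|^2/2}d\mu$, and $\mathcal F^1\subseteq\mathcal F^s$
-- transfers this to every target. So the embedding into $L^1(\sigma_1)$ controls $T_\mu$, and its
-- boundedness also makes the natural domain the whole space.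
--
-- Part (i): all the quantities are comparable to $\sup_a\mu(D(a,1))$. Integrating the local
-- estimate against $\mu$ and exchanging the integrals bounds the embedding into $L^1(\sigma_1)$ by
-- this supremum; since $\mathcal F^1$ functions have bounded weighted modulus, the $q$-th power of
-- the embedding norm into $L^q(\sigma_q)$ is bounded by it too. Conversely, testing the embedding
-- on $k_a$, or evaluating $T_\mu k_a$ at $a$ (the Berezin transform), recovers $\mu(D(a,1))$.
-- Compactness corresponds to $\mu(D(a,1))\to0$ at infinity. If this holds, the embedding has small
-- tails (`CarlesonTight`), and Montel's theorem handles the bounded part. If it fails, kernels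
-- $k_{a_m}$ with $|a_m|\to\infty$ tend to zero pointwise while their images stay large.
--
-- Part (ii): the criterion is that the masses $\mu(D(z_j,r))$ over a separated covering family lie
-- in $\ell^{p'}$. Sufficiency is the local estimate plus Hölder. For necessity, $T_\mu$ is applied
-- to $\sum\pm l_jk_{z_j}$, the image is sampled at the points $z_j$, and averaging over the signs
-- isolates the diagonal terms (`exists_sum_mul_measure_ball_le`); duality then gives the
-- $\ell^{p'}$ bound. Since $p'<\infty$, the tail of the sum is small, so boundedness already forces
-- compactness.

/-- The Gaussian `e^{-c|x|²}` as an extended nonnegative real. -/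
noncomputable def gauss {n : ℕ} (c : ℝ) (x : Cn n) : ℝ≥0∞ :=
  ENNReal.ofReal (Real.exp (-c * ‖x‖ ^ 2))

/-- The weighted function `f(z) e^{-α|z|²/2}`. -/
noncomputable def weighted {n : ℕ} (α : ℝ) (f : Cn n → ℂ) (z : Cn n) : ℂ :=
  f z * (Real.exp (-(α / 2) * ‖z‖ ^ 2) : ℂ)

/-- The normalized reproducing kernel `k_a = K_a e^{-α|a|²/2}`. -/
noncomputable def normKernel {n : ℕ} (α : ℝ) (a z : Cn n) : ℂ :=
  fockKernel α a z * (Real.exp (-(α / 2) * ‖a‖ ^ 2) : ℂ)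

/-- The normalizing constant in the Fock norm. -/
noncomputable def fockConst (n : ℕ) (α : ℝ) (p : ℝ≥0∞) : ℝ≥0∞ :=
  if p = ⊤ then 1 else ENNReal.ofReal ((α * p.toReal / (2 * Real.pi)) ^ n) ^ (1 / p.toReal)

-- Gaussians, weighted functions and normalized kernels

section Basic

variable {n : ℕ} {α : ℝ}

@[fun_prop]
lemma continuous_gauss (c : ℝ) : Continuous (gauss c : Cn n → ℝ≥0∞) := by
  exact ENNReal.continuous_ofReal.comp (by fun_prop)

lemma gauss_ne_top (c : ℝ) (x : Cn n) : gauss c x ≠ ⊤ := ENNReal.ofReal_ne_top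

lemma gauss_pos (c : ℝ) (x : Cn n) : 0 < gauss c x := ENNReal.ofReal_pos.2 (Real.exp_pos _)

lemma gauss_le_one {c : ℝ} (hc : 0 ≤ c) (x : Cn n) : gauss c x ≤ 1 := by
  unfold gauss
  rw [ENNReal.ofReal_le_one, Real.exp_le_one_iff]
  nlinarith [sq_nonneg ‖x‖, mul_nonneg hc (sq_nonneg ‖x‖)]

lemma gauss_neg (c : ℝ) (x : Cn n) : gauss c (-x) = gauss c x := by simp [gauss]

lemma gauss_sub_comm (c : ℝ) (x y : Cn n) : gauss c (x - y) = gauss c (y - x) := by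
  rw [← gauss_neg, neg_sub]

lemma gauss_rpow (c q : ℝ) (x : Cn n) : gauss c x ^ q = gauss (c * q) x := by
  unfold gauss
  rw [ENNReal.ofReal_rpow_of_pos (Real.exp_pos _), ← Real.exp_mul]
  congr 2; ring

lemma gauss_mul (b c : ℝ) (x : Cn n) : gauss b x * gauss c x = gauss (b + c) x := by
  unfold gauss
  rw [← ENNReal.ofReal_mul (Real.exp_pos _).le, ← Real.exp_add]
  congr 2; ring

lemma le_gauss_of_norm_le {c r : ℝ} (hc : 0 ≤ c) {x : Cn n} (hx : ‖x‖ ≤ r) :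
    ENNReal.ofReal (Real.exp (-c * r ^ 2)) ≤ gauss c x := by
  unfold gauss
  have : ‖x‖ ^ 2 ≤ r ^ 2 := by gcongr
  gcongr ENNReal.ofReal (Real.exp ?_)
  nlinarith

lemma lintegral_gauss {c : ℝ} (hc : 0 < c) :
    ∫⁻ z : Cn n, gauss c z = ENNReal.ofReal ((Real.pi / c) ^ n) := by
  have hfin : (Module.finrank ℝ (Cn n) : ℝ) / 2 = n := by
    have h : Module.finrank ℝ (Cn n) = 2 * n := by
      have := Module.finrank_mul_finrank ℝ ℂ (Cn n)
      rw [← this]; simp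
    rw [h]; push_cast; ring
  have hI := GaussianFourier.integral_rexp_neg_mul_sq_norm (V := Cn n) hc
  rw [hfin, Real.rpow_natCast] at hI
  rw [← hI, ofReal_integral_eq_lintegral_ofReal]
  · rfl
  -- Integrability is read off from the value: a non-integrable function would have Bochner integral
  -- 0, but the value is positive.
  · by_contra h
    rw [integral_undef h] at hI
    have : 0 < (Real.pi / c) ^ n := by positivity
    linarith
  · exact Eventually.of_forall fun x => (Real.exp_pos _).le

lemma lintegral_gauss_sub {c : ℝ} (hc : 0 < c) (a : Cn n) :
    ∫⁻ z : Cn n, gauss c (z - a) = ENNReal.ofReal ((Real.pi / c) ^ n) := by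
  rw [lintegral_sub_right_eq_self (fun z => gauss c z) a, lintegral_gauss hc]

lemma lintegral_gauss_ne_top {c : ℝ} (hc : 0 < c) (a : Cn n) :
    ∫⁻ z : Cn n, gauss c (z - a) ≠ ⊤ := by
  rw [lintegral_gauss_sub hc]; exact ENNReal.ofReal_ne_top

lemma enorm_weighted (f : Cn n → ℂ) (z : Cn n) :
    ‖weighted α f z‖ₑ = ‖f z‖ₑ * gauss (α / 2) z := by
  unfold weighted gauss
  rw [enorm_mul, ← ofReal_norm (Real.exp _ : ℂ), Complex.norm_real,
    Real.norm_of_nonneg (Real.exp_pos _).le]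

lemma enorm_weighted_rpow (f : Cn n → ℂ) (z : Cn n) {q : ℝ} (hq : 0 ≤ q) :
    ‖weighted α f z‖ₑ ^ q =
      ‖f z‖ₑ ^ q * ENNReal.ofReal (Real.exp (-(α * q / 2) * ‖z‖ ^ 2)) := by
  rw [enorm_weighted, ENNReal.mul_rpow_of_nonneg _ _ hq, gauss_rpow, gauss]
  congr 4; ring

lemma continuous_weighted {f : Cn n → ℂ} (hf : Continuous f) : Continuous (weighted α f) := by
  unfold weighted; fun_prop

lemma weighted_sub (f g : Cn n → ℂ) :
    weighted α (fun z => f z - g z) = weighted α f - weighted α g := by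
  ext z; simp [weighted, sub_mul]

lemma weighted_const_mul (c : ℂ) (f : Cn n → ℂ) :
    weighted α (fun z => c * f z) = c • weighted α f := by
  ext z; simp [weighted, mul_assoc]

/-- Strict superlevel sets of a continuous function are open, hence of positive measure when
nonempty, so the essential supremum misses no value. -/
lemma eLpNorm_top_eq_iSup {g : Cn n → ℂ} (hg : Continuous g) :
    eLpNorm g ⊤ volume = ⨆ z, ‖g z‖ₑ := by
  refine le_antisymm (by simpa using eLpNormEssSup_le_of_ae_enorm_bound (Eventually.of_forall fun z => le_iSup (fun z => ‖g z‖ₑ) z)) ?_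
  refine iSup_le fun z => le_of_not_gt fun h => ?_
  have hopen : IsOpen {x | eLpNorm g ⊤ volume < ‖g x‖ₑ} :=
    isOpen_lt continuous_const hg.enorm
  have hpos := hopen.measure_pos volume ⟨z, h⟩
  have hae := enorm_ae_le_eLpNormEssSup g volume
  rw [← eLpNorm_exponent_top] at hae
  have : volume {x | eLpNorm g ⊤ volume < ‖g x‖ₑ} = 0 := by
    simpa [ae_iff] using hae
  exact hpos.ne' this

lemma fockConst_pos (hα : 0 < α) {p : ℝ≥0∞} (hp : p ≠ 0) : 0 < fockConst n α p := by
  unfold fockConst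
  split_ifs with h
  · simp
  · have := ENNReal.toReal_pos hp h
    exact ENNReal.rpow_pos (by rw [ENNReal.ofReal_pos]; positivity) ENNReal.ofReal_ne_top

lemma fockConst_ne_top {p : ℝ≥0∞} : fockConst n α p ≠ ⊤ := by
  unfold fockConst
  split_ifs with h
  · simp
  · exact ENNReal.rpow_ne_top_of_nonneg (by positivity) ENNReal.ofReal_ne_top

lemma fockNorm_eq {p : ℝ≥0∞} (hp : p ≠ 0) {f : Cn n → ℂ} (hf : Continuous f) :
    fockNorm α p f = fockConst n α p * eLpNorm (weighted α f) p volume := by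
  unfold fockNorm fockConst
  split_ifs with h
  · subst h
    rw [one_mul, eLpNorm_top_eq_iSup (continuous_weighted hf)]
    simp only [enorm_weighted, gauss]
  · have := ENNReal.toReal_pos hp h
    rw [ENNReal.mul_rpow_of_nonneg _ _ (by positivity), eLpNorm_eq_lintegral_rpow_enorm_toReal hp h]
    simp only [enorm_weighted_rpow _ _ this.le]

/-- Moves the weight from the measure into the function, so that all exponents $q$ concern one
function and one measure $\mu$. -/
lemma eLpNorm_sigmaMeasure (μ : Measure (Cn n)) {q : ℝ} (hq : 0 < q) (f : Cn n → ℂ) :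
    eLpNorm f (ENNReal.ofReal q) (sigmaMeasure α μ q) =
      eLpNorm (weighted α f) (ENNReal.ofReal q) μ := by
  have hq0 : ENNReal.ofReal q ≠ 0 := by simpa using hq
  rw [eLpNorm_eq_lintegral_rpow_enorm_toReal hq0 ENNReal.ofReal_ne_top,
    eLpNorm_eq_lintegral_rpow_enorm_toReal hq0 ENNReal.ofReal_ne_top, sigmaMeasure,
    lintegral_withDensity_eq_lintegral_mul_non_measurable _ (by fun_prop) (by simp),
    ENNReal.toReal_ofReal hq.le]
  congr 1
  refine lintegral_congr fun z => ?_
  rw [enorm_weighted_rpow _ _ hq.le, Pi.mul_apply, mul_comm, mul_comm q α]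

lemma fockKernel_re (w z : Cn n) :
    ‖fockKernel α w z‖ = Real.exp (α * (inner ℂ w z).re) := by
  unfold fockKernel
  rw [Complex.norm_exp, Complex.re_ofReal_mul]

lemma norm_sub_sq_re (w z : Cn n) :
    ‖z - w‖ ^ 2 = ‖z‖ ^ 2 - 2 * (inner ℂ w z).re + ‖w‖ ^ 2 := by
  rw [@norm_sub_sq ℂ, inner_re_symm]; rfl

/-- Completing the square in $\alpha\,\mathrm{Re}\langle
z,a\rangle-\frac\alpha2|z|^2-\frac\alpha2|a|^2$. -/
lemma enorm_weighted_normKernel (a z : Cn n) :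
    ‖weighted α (normKernel α a) z‖ₑ = gauss (α / 2) (z - a) := by
  rw [enorm_weighted, normKernel, enorm_mul, ← ofReal_norm, fockKernel_re,
    ← ofReal_norm, Complex.norm_real, Real.norm_of_nonneg (Real.exp_pos _).le, gauss, gauss,
    ← ENNReal.ofReal_mul (Real.exp_pos _).le, ← ENNReal.ofReal_mul (by positivity),
    ← Real.exp_add, ← Real.exp_add, norm_sub_sq_re]
  congr 2; ring

lemma differentiable_fockKernel (w : Cn n) : Differentiable ℂ (fockKernel α w) := by
  unfold fockKernel
  have : Differentiable ℂ fun z : Cn n => inner ℂ w z := (innerSL ℂ w).differentiable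
  fun_prop

lemma differentiable_normKernel (a : Cn n) : Differentiable ℂ (normKernel α a) := by
  unfold normKernel
  exact (differentiable_fockKernel a).mul_const _

@[fun_prop]
lemma Continuous.fockKernel {X : Type*} [TopologicalSpace X] {f g : X → Cn n}
    (hf : Continuous f) (hg : Continuous g) : Continuous fun x => fockKernel α (f x) (g x) := by
  unfold _root_.fockKernel
  exact Complex.continuous_exp.comp (continuous_const.mul (hf.inner hg))

lemma fockNorm_normKernel (hα : 0 < α) {p : ℝ≥0∞} (hp : p ≠ 0) (a : Cn n) :
    fockNorm α p (normKernel α a) = 1 := by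
  unfold fockNorm
  split_ifs with h
  · have : ∀ z, ‖normKernel α a z‖ₑ * ENNReal.ofReal (Real.exp (-(α / 2) * ‖z‖ ^ 2)) =
        gauss (α / 2) (z - a) := fun z => by
      rw [← enorm_weighted_normKernel, enorm_weighted]; rfl
    simp only [this]
    refine le_antisymm (iSup_le fun z => gauss_le_one (by positivity) _) ?_
    refine le_trans ?_ (le_iSup _ a)
    simp [gauss]
  · have hp' := ENNReal.toReal_pos hp h
    simp only [← enorm_weighted_rpow _ _ hp'.le, enorm_weighted_normKernel, gauss_rpow]
    rw [lintegral_gauss_sub (by positivity), ← ENNReal.ofReal_mul (by positivity), ← mul_pow]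
    have : α * p.toReal / (2 * Real.pi) * (Real.pi / (α / 2 * p.toReal)) = 1 := by
      field_simp
    rw [this]; simp

lemma memFock_normKernel (hα : 0 < α) {p : ℝ≥0∞} (hp : p ≠ 0) (a : Cn n) :
    MemFock α p (normKernel α a) :=
  ⟨differentiable_normKernel a, by rw [fockNorm_normKernel hα hp]; simp⟩

end Basic

-- Mean value property and local estimates

section MeanValue

variable {n : ℕ} {α : ℝ}

/-- The mean value property for entire functions and circularly symmetric finite measures. -/
lemma integral_eq_of_circular (ρ : Measure (Cn n)) [IsFiniteMeasure ρ]
    (hρ : ∀ c : ℂ, ‖c‖ = 1 → MeasurePreserving (fun u : Cn n => c • u) ρ ρ)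
    {g : Cn n → ℂ} (hg : Differentiable ℂ g) (hint : Integrable g ρ) :
    ∫ u, g u ∂ρ = ρ.real Set.univ * g 0 := by
  have hc : ∀ θ : ℝ, ‖circleMap 0 1 θ‖ = 1 := fun θ => by simp
  have hemb : ∀ θ : ℝ, MeasurableEmbedding (fun u : Cn n => circleMap 0 1 θ • u) := fun θ =>
    (Homeomorph.smulOfNeZero (circleMap 0 1 θ) (by simp)).measurableEmbedding
  have hrot : ∀ θ : ℝ, ∫ u, g (circleMap 0 1 θ • u) ∂ρ = ∫ u, g u ∂ρ := fun θ =>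
    (hρ _ (hc θ)).integral_comp (hemb θ) g
  have hcont : Continuous fun x : ℝ × Cn n => g (circleMap 0 1 x.1 • x.2) := by
    have := hg.continuous
    have h2 := continuous_circleMap 0 1
    fun_prop
  have hprod : Integrable (fun x : ℝ × Cn n => g (circleMap 0 1 x.1 • x.2))
      ((volume.restrict (Set.Ioc 0 (2 * Real.pi))).prod ρ) := by
    rw [integrable_prod_iff hcont.aestronglyMeasurable]
    refine ⟨Eventually.of_forall fun θ =>
      ((hρ _ (hc θ)).integrable_comp_emb (hemb θ)).2 hint, ?_⟩
    have : ∀ θ : ℝ, ∫ u, ‖g (circleMap 0 1 θ • u)‖ ∂ρ = ∫ u, ‖g u‖ ∂ρ := fun θ =>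
      (hρ _ (hc θ)).integral_comp (hemb θ) fun u => ‖g u‖
    simp only [this]
    exact integrable_const _
  -- The one-variable mean value property on the complex line through $u$; the rotation invariance
  -- of $\rho$ then makes averaging over $\theta$ free.
  have hmean : ∀ u : Cn n, ∫ θ in Set.Ioc 0 (2 * Real.pi), g (circleMap 0 1 θ • u)
      = 2 * Real.pi * g 0 := fun u => by
    have hd : Differentiable ℂ fun c : ℂ => g (c • u) := by fun_prop
    have := (hd.diffContOnCl (s := Metric.ball 0 |(1 : ℝ)|)).circleAverage
    rw [Real.circleAverage_def, intervalIntegral.integral_of_le (by positivity)] at this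
    rw [zero_smul, inv_smul_eq_iff₀ (by positivity)] at this
    rw [this, Complex.real_smul]; push_cast; ring
  have hswap := integral_integral_swap (f := fun (θ : ℝ) u => g (circleMap 0 1 θ • u)) hprod
  simp only [hrot, hmean] at hswap
  rw [integral_const, integral_const, Complex.real_smul, Complex.real_smul] at hswap
  have hv : (volume.restrict (Set.Ioc 0 (2 * Real.pi))).real Set.univ = 2 * Real.pi := by
    simp [Real.pi_pos.le]
  rw [hv] at hswap
  have h0 : ((2 * Real.pi : ℝ) : ℂ) ≠ 0 := by exact_mod_cast (by positivity : (2 * Real.pi) ≠ 0)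
  apply mul_left_cancel₀ h0
  rw [hswap]; push_cast; ring

lemma measurePreserving_unit_smul {c : ℂ} (hc : ‖c‖ = 1) :
    MeasurePreserving (fun u : Cn n => c • u) volume volume := by
  have hc' : c ∈ Submonoid.unitSphere ℂ := by simpa [Submonoid.unitSphere] using hc
  let e : Cn n ≃ₗᵢ[ℝ] Cn n :=
    { LinearEquiv.restrictScalars ℝ
        (LinearEquiv.smulOfNeZero ℂ (Cn n) c (by rintro rfl; simp at hc)) with
      norm_map' := fun x => by
        change ‖c • x‖ = ‖x‖
        rw [norm_smul, hc, one_mul] }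
  exact e.measurePreserving

lemma measurePreserving_unit_smul_withDensity {c : ℂ} (hc : ‖c‖ = 1) (b : ℝ) :
    MeasurePreserving (fun u : Cn n => c • u) (volume.withDensity (gauss b))
      (volume.withDensity (gauss b)) := by
  refine ⟨by fun_prop, ?_⟩
  ext s hs
  rw [Measure.map_apply (by fun_prop) hs, withDensity_apply _ hs,
    withDensity_apply _ (measurableSet_preimage (by fun_prop) hs)]
  rw [← (measurePreserving_unit_smul hc).setLIntegral_comp_preimage hs
    (continuous_gauss b).measurable]
  simp [gauss, norm_smul, hc]

/-- Translation of an entire function by `w`, adapted to the Gaussian weight. -/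
noncomputable def weylShift {n : ℕ} (α : ℝ) (f : Cn n → ℂ) (w u : Cn n) : ℂ :=
  f (w + u) * Complex.exp (-(α * inner ℂ w u))

lemma differentiable_weylShift {f : Cn n → ℂ} (hf : Differentiable ℂ f) (w : Cn n) :
    Differentiable ℂ (weylShift α f w) := by
  have : Differentiable ℂ fun z : Cn n => inner ℂ w z := (innerSL ℂ w).differentiable
  unfold weylShift; fun_prop

/-- The exponential factor cancels the cross term of $|w+u|^2$, so the shift is an isometry for the
weighted moduli. -/
lemma enorm_weylShift (f : Cn n → ℂ) (w u : Cn n) :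
    ‖weylShift α f w u‖ₑ * gauss (α / 2) u * gauss (α / 2) w = ‖weighted α f (w + u)‖ₑ := by
  rw [enorm_weighted, weylShift, enorm_mul, ← ofReal_norm (Complex.exp _), Complex.norm_exp,
    mul_assoc, mul_assoc]
  congr 1
  unfold gauss
  rw [← ENNReal.ofReal_mul (by positivity), ← ENNReal.ofReal_mul (by positivity),
    ← Real.exp_add, ← Real.exp_add]
  congr 2
  have h := norm_sub_sq_re w (-u)
  rw [← norm_neg, neg_sub, sub_neg_eq_add, norm_neg, inner_neg_right] at h
  rw [h, Complex.neg_re, Complex.neg_re, Complex.re_ofReal_mul]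
  ring

/-- The Weyl shift moves $w$ to the origin, where the plain mean value property over a ball applies.
The Gaussian weight, at least $e^{-\alpha\delta^2/2}$ on that ball, can then be reinserted, so the
constant does not depend on $w$. -/
lemma exists_enorm_weighted_le_lintegral_ball (n : ℕ) (α : ℝ) (hα : 0 < α) {δ : ℝ} (hδ : 0 < δ) :
    ∃ C : ℝ≥0, 0 < C ∧ ∀ f : Cn n → ℂ, Differentiable ℂ f → ∀ w,
      ‖weighted α f w‖ₑ ≤ C * ∫⁻ z in Metric.ball w δ, ‖weighted α f z‖ₑ := by
  set B : Set (Cn n) := Metric.ball 0 δ with hB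
  have hV0 : volume B ≠ 0 := (Metric.measure_ball_pos volume 0 hδ).ne'
  have hVt : volume B ≠ ⊤ := measure_ball_lt_top.ne
  set e : ℝ≥0∞ := ENNReal.ofReal (Real.exp (-(α / 2) * δ ^ 2)) with he
  have he0 : e ≠ 0 := by simp [he, Real.exp_pos]
  have het : e ≠ ⊤ := ENNReal.ofReal_ne_top
  have hC : (volume B * e)⁻¹ ≠ ⊤ := ENNReal.inv_ne_top.2 (mul_ne_zero hV0 he0)
  refine ⟨((volume B * e)⁻¹).toNNReal, ?_, fun f hf w => ?_⟩
  · exact ENNReal.toNNReal_pos (ENNReal.inv_ne_zero.2 (ENNReal.mul_ne_top hVt het)) hC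
  rw [ENNReal.coe_toNNReal hC, mul_comm, ← div_eq_mul_inv,
    ENNReal.le_div_iff_mul_le (Or.inl (mul_ne_zero hV0 he0)) (Or.inl (ENNReal.mul_ne_top hVt het))]
  have hg := differentiable_weylShift (α := α) hf w
  have hρ : ∀ c : ℂ, ‖c‖ = 1 → MeasurePreserving (fun u : Cn n => c • u)
      (volume.restrict B) (volume.restrict B) := fun c hc => by
    have := (measurePreserving_unit_smul hc).restrict_preimage
      (s := B) Metric.isOpen_ball.measurableSet
    convert this using 2
    ext u; simp [hB, norm_smul, hc]
  have : IsFiniteMeasure (volume.restrict B) := ⟨by simpa using hVt.lt_top⟩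
  have hint : Integrable (weylShift α f w) (volume.restrict B) :=
    (hg.continuous.continuousOn.integrableOn_compact
      (isCompact_closedBall (0 : Cn n) δ)).mono_set Metric.ball_subset_closedBall
  have hm := integral_eq_of_circular _ hρ hg hint
  have h1 : volume B * ‖weylShift α f w 0‖ₑ ≤ ∫⁻ u in B, ‖weylShift α f w u‖ₑ := by
    refine le_trans (le_of_eq ?_) (enorm_integral_le_lintegral_enorm _)
    rw [hm, enorm_mul, ← ofReal_norm (((volume.restrict B).real Set.univ : ℝ) : ℂ),
      Complex.norm_real, Real.norm_of_nonneg measureReal_nonneg]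
    simp [Measure.real, ENNReal.ofReal_toReal hVt]
  have h2 : ‖weighted α f w‖ₑ = ‖weylShift α f w 0‖ₑ * gauss (α / 2) w := by
    have := enorm_weylShift (α := α) f w 0
    rw [add_zero] at this
    rw [← this]; simp [gauss]
  have h3 : ∫⁻ z in Metric.ball w δ, ‖weighted α f z‖ₑ
      = ∫⁻ u in B, ‖weighted α f (w + u)‖ₑ := by
    have := (measurePreserving_add_left volume w).setLIntegral_comp_preimage
      (s := Metric.ball w δ) Metric.isOpen_ball.measurableSet
      (continuous_weighted (α := α) hf.continuous).enorm.measurable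
    rw [← this]
    congr 2
    ext u; simp [hB]
  rw [h3]
  calc ‖weighted α f w‖ₑ * (volume B * e)
      = (volume B * ‖weylShift α f w 0‖ₑ) * (e * gauss (α / 2) w) := by rw [h2]; ring
    _ ≤ (∫⁻ u in B, ‖weylShift α f w u‖ₑ) * (e * gauss (α / 2) w) := by gcongr
    _ = ∫⁻ u in B, ‖weylShift α f w u‖ₑ * (e * gauss (α / 2) w) := by
        rw [lintegral_mul_const _ hg.continuous.enorm.measurable]
    _ ≤ ∫⁻ u in B, ‖weighted α f (w + u)‖ₑ := by
        refine setLIntegral_mono' Metric.isOpen_ball.measurableSet fun u hu => ?_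
        rw [← enorm_weylShift, mul_assoc]
        gcongr
        refine le_gauss_of_norm_le (by positivity) ?_
        exact (mem_ball_zero_iff.1 hu).le

lemma exists_enorm_weighted_le_eLpNorm_ball (n : ℕ) (α : ℝ) (hα : 0 < α) {δ : ℝ} (hδ : 0 < δ)
    {p : ℝ≥0∞} (hp : 1 ≤ p) :
    ∃ C : ℝ≥0, 0 < C ∧ ∀ f : Cn n → ℂ, Differentiable ℂ f → ∀ w,
      ‖weighted α f w‖ₑ ≤ C * eLpNorm (weighted α f) p (volume.restrict (Metric.ball w δ)) := by
  obtain ⟨C, hC, h⟩ := exists_enorm_weighted_le_lintegral_ball n α hα hδ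
  set V : ℝ≥0∞ := volume (Metric.ball (0 : Cn n) δ) ^ (1 / (1 : ℝ≥0∞).toReal - 1 / p.toReal) with hV
  have hV0 : volume (Metric.ball (0 : Cn n) δ) ≠ 0 := (Metric.measure_ball_pos volume 0 hδ).ne'
  have hVt : volume (Metric.ball (0 : Cn n) δ) ≠ ⊤ := measure_ball_lt_top.ne
  have hV1 : V ≠ ⊤ := ENNReal.rpow_ne_top_of_ne_zero hV0 hVt
  have hV2 : 0 < V := ENNReal.rpow_pos (pos_iff_ne_zero.2 hV0) hVt
  refine ⟨C * V.toNNReal, mul_pos hC (ENNReal.toNNReal_pos hV2.ne' hV1), fun f hf w => ?_⟩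
  refine (h f hf w).trans ?_
  rw [ENNReal.coe_mul, ENNReal.coe_toNNReal hV1, ← eLpNorm_one_eq_lintegral_enorm, mul_assoc]
  gcongr
  have := eLpNorm_le_eLpNorm_mul_rpow_measure_univ (μ := volume.restrict (Metric.ball w δ)) hp
    (continuous_weighted (α := α) hf.continuous).aestronglyMeasurable
  refine this.trans (le_of_eq ?_)
  rw [Measure.restrict_apply_univ, Measure.addHaar_ball_center volume w, mul_comm]

lemma exists_enorm_weighted_le_fockNorm (n : ℕ) (α : ℝ) (hα : 0 < α) {p : ℝ≥0∞} (hp : 1 ≤ p) :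
    ∃ C : ℝ≥0, 0 < C ∧ ∀ f : Cn n → ℂ, Differentiable ℂ f → ∀ w,
      ‖weighted α f w‖ₑ ≤ C * fockNorm α p f := by
  obtain ⟨C, hC, h⟩ := exists_enorm_weighted_le_eLpNorm_ball n α hα one_pos hp
  have hp0 : p ≠ 0 := (one_pos.trans_le hp).ne'
  have h0 := fockConst_pos (n := n) hα hp0
  have ht := fockConst_ne_top (n := n) (α := α) (p := p)
  refine ⟨C * (fockConst n α p)⁻¹.toNNReal, mul_pos hC (ENNReal.toNNReal_pos
    (ENNReal.inv_ne_zero.2 ht) (ENNReal.inv_ne_top.2 h0.ne')), fun f hf w => ?_⟩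
  rw [ENNReal.coe_mul, ENNReal.coe_toNNReal (ENNReal.inv_ne_top.2 h0.ne'), mul_assoc,
    fockNorm_eq hp0 hf.continuous, ← mul_assoc _ (fockConst n α p), ENNReal.inv_mul_cancel h0.ne' ht,
    one_mul]
  refine (h f hf w).trans ?_
  gcongr
  exact Measure.restrict_le_self

lemma eq_zero_of_fockNorm_eq_zero (hα : 0 < α) {p : ℝ≥0∞} (hp : 1 ≤ p) {f : Cn n → ℂ}
    (hf : Differentiable ℂ f) (h : fockNorm α p f = 0) : f = 0 := by
  obtain ⟨C, -, hC⟩ := exists_enorm_weighted_le_fockNorm n α hα hp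
  ext z
  have := hC f hf z
  rw [h, mul_zero, nonpos_iff_eq_zero, enorm_weighted, mul_eq_zero] at this
  simpa using this.resolve_right (gauss_pos _ _).ne'

/-- Since $|g|^q\le A^{q-1}|g|$, estimates for exponent $q$ reduce to exponent 1. -/
lemma lintegral_enorm_rpow_le {X : Type*} [MeasurableSpace X] {μ : Measure X} {g : X → ℂ}
    {A : ℝ≥0∞} {q : ℝ} (hq : 1 ≤ q) (hg : AEMeasurable (fun x => ‖g x‖ₑ) μ)
    (hA : ∀ x, ‖g x‖ₑ ≤ A) :
    ∫⁻ x, ‖g x‖ₑ ^ q ∂μ ≤ A ^ (q - 1) * ∫⁻ x, ‖g x‖ₑ ∂μ := by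
  rw [← lintegral_const_mul'' _ hg]
  refine lintegral_mono fun x => ?_
  have : ‖g x‖ₑ ^ q = ‖g x‖ₑ ^ (q - 1) * ‖g x‖ₑ := by
    conv_lhs => rw [← sub_add_cancel q 1]
    rw [ENNReal.rpow_add_of_nonneg _ _ (by linarith) zero_le_one, ENNReal.rpow_one]
  simp only [this]
  gcongr
  exact hA x

lemma eLpNorm_le_of_enorm_le {X : Type*} [MeasurableSpace X] {μ : Measure X} {g : X → ℂ}
    {A : ℝ≥0∞} {p : ℝ≥0∞} (hp : 1 ≤ p) (hg : AEMeasurable (fun x => ‖g x‖ₑ) μ)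
    (hA : ∀ x, ‖g x‖ₑ ≤ A) (h1 : ∫⁻ x, ‖g x‖ₑ ∂μ ≤ A) : eLpNorm g p μ ≤ A := by
  rcases eq_or_ne p ⊤ with rfl | hpt
  · simpa using eLpNormEssSup_le_of_ae_enorm_bound (Eventually.of_forall hA)
  have hp0 : p ≠ 0 := (one_pos.trans_le hp).ne'
  have hp1 : 1 ≤ p.toReal := by
    simpa using ENNReal.toReal_mono hpt hp
  rw [eLpNorm_eq_lintegral_rpow_enorm_toReal hp0 hpt, one_div,
    ENNReal.rpow_inv_le_iff (by linarith)]
  refine (lintegral_enorm_rpow_le hp1 hg hA).trans ?_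
  calc A ^ (p.toReal - 1) * ∫⁻ x, ‖g x‖ₑ ∂μ ≤ A ^ (p.toReal - 1) * A ^ (1 : ℝ) := by
        rw [ENNReal.rpow_one]; gcongr
    _ = A ^ p.toReal := by
        rw [← ENNReal.rpow_add_of_nonneg _ _ (by linarith) zero_le_one, sub_add_cancel]

/-- The continuous inclusion `F^1 ⊆ F^p`. -/
lemma exists_fockNorm_le_fockNorm_one (n : ℕ) (α : ℝ) (hα : 0 < α) {p : ℝ≥0∞} (hp : 1 ≤ p) :
    ∃ C : ℝ≥0, 0 < C ∧ ∀ f : Cn n → ℂ, Differentiable ℂ f →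
      fockNorm α p f ≤ C * fockNorm α 1 f := by
  obtain ⟨C, hC, h⟩ := exists_enorm_weighted_le_lintegral_ball n α hα one_pos
  have hp0 : p ≠ 0 := (one_pos.trans_le hp).ne'
  have h1 := (fockConst_pos (n := n) hα one_ne_zero).ne'
  have ht := fockConst_ne_top (n := n) (α := α) (p := 1)
  have hi := ENNReal.inv_ne_top.2 h1
  have hpt := fockConst_ne_top (n := n) (α := α) (p := p)
  -- The factor $C+1$ dominates both the sup bound (factor $C$) and the $L^1$ bound (factor 1)
  -- required for interpolation.
  refine ⟨(fockConst n α p).toNNReal * (C + 1) * (fockConst n α 1)⁻¹.toNNReal,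
    mul_pos (mul_pos (ENNReal.toNNReal_pos (fockConst_pos hα hp0).ne' hpt) (by positivity))
      (ENNReal.toNNReal_pos (ENNReal.inv_ne_zero.2 ht) hi), fun f hf => ?_⟩
  rw [ENNReal.coe_mul, ENNReal.coe_mul, ENNReal.coe_toNNReal hpt, ENNReal.coe_toNNReal hi,
    fockNorm_eq hp0 hf.continuous, fockNorm_eq one_ne_zero hf.continuous, mul_assoc, mul_assoc,
    ← mul_assoc _ (fockConst n α 1), ENNReal.inv_mul_cancel h1 ht, one_mul,
    eLpNorm_one_eq_lintegral_enorm]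
  gcongr
  refine eLpNorm_le_of_enorm_le hp (continuous_weighted hf.continuous).enorm.measurable.aemeasurable
    (fun z => (h f hf z).trans ?_) ?_
  · gcongr
    · exact le_self_add
    · exact Measure.restrict_le_self
  · rw [ENNReal.coe_add, ENNReal.coe_one, add_mul, one_mul]
    exact le_add_self

end MeanValue

-- Kernel superpositions, the reproducing formula and Montel's theorem

section Holomorphy

variable {n : ℕ} {α : ℝ}

lemma hasFDerivAt_fockKernel (w z : Cn n) :
    HasFDerivAt (fockKernel α w) ((fockKernel α w z * α) • innerSL ℂ w) z := by
  have h : HasFDerivAt (fun z : Cn n => (α : ℂ) * inner ℂ w z) ((α : ℂ) • innerSL ℂ w) z :=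
    ((innerSL ℂ w).hasFDerivAt).const_mul _
  have := h.cexp
  rwa [smul_smul] at this

/-- Near every point, `|w| |K_w(z)|` is dominated by finitely many kernel functions of `w`. -/
lemma exists_norm_mul_norm_fockKernel_le (hα : 0 < α) (z₀ : Cn n) :
    ∃ (s : Finset (Cn n)) (ε C : ℝ), 0 < ε ∧ 0 ≤ C ∧ ∀ z ∈ Metric.ball z₀ ε, ∀ w,
      ‖w‖ * ‖fockKernel α w z‖ ≤ C * ∑ b ∈ s, ‖fockKernel α w b‖ := by
  -- The finitely many points are the vertices of a simplex with $z_0$ in its interior.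
  obtain ⟨b, hb, -⟩ := exists_mem_interior_convexHull_affineBasis
    (Filter.univ_mem : Set.univ ∈ 𝓝 z₀)
  obtain ⟨ρ, hρ, hsub⟩ := Metric.isOpen_iff.1 isOpen_interior z₀ hb
  refine ⟨(Set.toFinite (Set.range b)).toFinset, ρ / 2, 4 / (α * ρ), by positivity, by positivity,
    fun z hz w => ?_⟩
  rcases eq_or_ne w 0 with rfl | hw
  · rw [norm_zero, zero_mul]; positivity
  have hw' : 0 < ‖w‖ := norm_pos_iff.2 hw
  -- Moving $z$ by $\rho/4$ in the direction of $w$ multiplies $|K_w|$ by $e^{\alpha\rho|w|/4}$,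
  -- which absorbs the factor $|w|$, and stays inside the simplex.
  set y : Cn n := z + ((ρ / 4 / ‖w‖ : ℝ) : ℂ) • w with hy
  have hyn : dist y z < ρ / 2 := by
    rw [hy, dist_eq_norm, add_sub_cancel_left, norm_smul, Complex.norm_real,
      Real.norm_of_nonneg (by positivity), div_mul_cancel₀ _ hw'.ne']
    linarith
  have hyhull : y ∈ convexHull ℝ (Set.range b) := by
    refine interior_subset (hsub ?_)
    rw [Metric.mem_ball]
    calc dist y z₀ ≤ dist y z + dist z z₀ := dist_triangle _ _ _
      _ < ρ / 2 + ρ / 2 := add_lt_add hyn (Metric.mem_ball.1 hz)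
      _ = ρ := by ring
  -- A real-linear functional on a simplex is maximal at a vertex, so the kernel at $y$ is dominated
  -- by the kernel at some vertex.
  have hlin : ConvexOn ℝ Set.univ fun x : Cn n => (inner ℂ w x).re := by
    refine ⟨convex_univ, fun x _ x' _ a c _ _ _ => le_of_eq ?_⟩
    beta_reduce
    rw [inner_add_right, ← Complex.coe_smul a x, ← Complex.coe_smul c x', inner_smul_right,
      inner_smul_right]
    simp
  obtain ⟨v, hv, hle⟩ := hlin.exists_ge_of_mem_convexHull (Set.subset_univ _) hyhull
  have hre : (inner ℂ w y).re = (inner ℂ w z).re + ρ / 4 * ‖w‖ := by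
    rw [hy, inner_add_right, inner_smul_right, Complex.add_re, Complex.re_ofReal_mul,
      inner_self_eq_norm_sq_to_K]
    have : (((‖w‖ : ℂ) ^ 2).re) = ‖w‖ ^ 2 := by
      rw [← Complex.ofReal_pow, Complex.ofReal_re]
    change _ + _ * ((‖w‖ : ℂ) ^ 2).re = _
    rw [this]; field_simp
  calc ‖w‖ * ‖fockKernel α w z‖
      ≤ (4 / (α * ρ) * Real.exp (α * (ρ / 4 * ‖w‖))) * ‖fockKernel α w z‖ := by
        gcongr
        have := Real.add_one_le_exp (α * (ρ / 4 * ‖w‖))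
        calc ‖w‖ = 4 / (α * ρ) * (α * (ρ / 4 * ‖w‖)) := by field_simp
          _ ≤ _ := by gcongr; linarith
    _ = 4 / (α * ρ) * Real.exp (α * (inner ℂ w y).re) := by
        rw [fockKernel_re, hre, mul_assoc, ← Real.exp_add]; congr 2; ring
    _ ≤ 4 / (α * ρ) * ‖fockKernel α w v‖ := by
        rw [fockKernel_re]; gcongr
    _ ≤ 4 / (α * ρ) * ∑ b ∈ (Set.toFinite (Set.range b)).toFinset, ‖fockKernel α w b‖ := by
        gcongr
        exact Finset.single_le_sum (f := fun b => ‖fockKernel α w b‖)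
          (fun _ _ => norm_nonneg _) (by simpa using hv)

/-- Absolutely convergent superpositions of kernel functions are entire. -/
lemma differentiable_integral_fockKernel (hα : 0 < α) {μ : Measure (Cn n)} {h : Cn n → ℂ}
    (hh : AEStronglyMeasurable h μ)
    (hint : ∀ z, Integrable (fun w => fockKernel α w z * h w) μ) :
    Differentiable ℂ fun z => ∫ w, fockKernel α w z * h w ∂μ := by
  intro z₀
  obtain ⟨s, ε, C, hε, hC, hbd⟩ := exists_norm_mul_norm_fockKernel_le hα z₀
  have hcont : ∀ z : Cn n, Continuous fun w : Cn n => fockKernel α w z := fun z => by fun_prop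
  have hF := hasFDerivAt_integral_of_dominated_of_fderiv_le (μ := μ) (𝕜 := ℂ)
    (F := fun z w => fockKernel α w z * h w)
    (F' := fun z w => h w • ((fockKernel α w z * α) • innerSL ℂ w))
    (bound := fun w => |α| * (C * ∑ b ∈ s, ‖fockKernel α w b * h w‖)) (x₀ := z₀)
    (Metric.ball_mem_nhds z₀ hε) ?_ (hint z₀) ?_ ?_ ?_ ?_
  · exact hF.differentiableAt
  · exact Eventually.of_forall fun z => (hint z).aestronglyMeasurable
  · refine hh.smul (Continuous.aestronglyMeasurable ?_)
    exact ((hcont z₀).mul continuous_const).smul (innerSL ℂ).continuous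
  · refine Eventually.of_forall fun w z hz => ?_
    rw [norm_smul, norm_smul, norm_mul, Complex.norm_real, innerSL_apply_norm, Real.norm_eq_abs]
    have := hbd z hz w
    calc ‖h w‖ * (‖fockKernel α w z‖ * |α| * ‖w‖)
        = |α| * ((‖w‖ * ‖fockKernel α w z‖) * ‖h w‖) := by ring
      _ ≤ |α| * ((C * ∑ b ∈ s, ‖fockKernel α w b‖) * ‖h w‖) := by gcongr
      _ = _ := by simp only [norm_mul, ← Finset.sum_mul]; ring
  · exact ((integrable_finsetSum s fun b _ => (hint b).norm).const_mul C).const_mul _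
  · refine Eventually.of_forall fun w z _ => ?_
    exact (hasFDerivAt_fockKernel w z).mul_const (h w)

/-- The growth condition defining `F^∞`, with an explicit bound. -/
lemma norm_le_of_enorm_weighted_le {f : Cn n → ℂ} {z : Cn n} {A : ℝ≥0}
    (h : ‖weighted α f z‖ₑ ≤ A) : ‖f z‖ ≤ A * Real.exp (α / 2 * ‖z‖ ^ 2) := by
  have h' : ‖weighted α f z‖ ≤ A := by
    rw [← enorm_norm] at h
    simpa [← ofReal_norm, ENNReal.ofReal_le_iff_le_toReal] using h
  rw [weighted, norm_mul, Complex.norm_real, Real.norm_of_nonneg (Real.exp_pos _).le] at h'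
  calc ‖f z‖ = ‖f z‖ * Real.exp (-(α / 2) * ‖z‖ ^ 2) * Real.exp (α / 2 * ‖z‖ ^ 2) := by
        rw [mul_assoc, ← Real.exp_add]; simp
    _ ≤ _ := by gcongr

/-- The integrand of the reproducing formula is dominated by a Gaussian. -/
lemma enorm_reproducing_integrand (f : Cn n → ℂ) (z v : Cn n) :
    ‖fockKernel α v z * (f v * (Real.exp (-α * ‖v‖ ^ 2) : ℂ))‖ₑ * gauss (α / 2) z =
      ‖weighted α f v‖ₑ * gauss (α / 2) (z - v) := by
  rw [← enorm_weighted_normKernel, enorm_weighted, enorm_weighted, normKernel]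
  simp only [enorm_mul]
  have : ‖(Real.exp (-α * ‖v‖ ^ 2) : ℂ)‖ₑ =
      gauss (α / 2) v * ‖(Real.exp (-(α / 2) * ‖v‖ ^ 2) : ℂ)‖ₑ := by
    rw [← ofReal_norm, ← ofReal_norm, Complex.norm_real, Complex.norm_real,
      Real.norm_of_nonneg (Real.exp_pos _).le, Real.norm_of_nonneg (Real.exp_pos _).le, gauss,
      ← ENNReal.ofReal_mul (Real.exp_pos _).le, ← Real.exp_add]
    congr 2; ring
  rw [this]; ring

lemma integrable_reproducing (hα : 0 < α) {f : Cn n → ℂ} (hf : Measurable f) {A : ℝ≥0}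
    (hA : ∀ z, ‖weighted α f z‖ₑ ≤ A) (z : Cn n) :
    Integrable fun v => fockKernel α v z * (f v * (Real.exp (-α * ‖v‖ ^ 2) : ℂ)) := by
  have hk : Continuous fun v : Cn n => fockKernel α v z := by fun_prop
  refine ⟨(hk.measurable.mul (hf.mul (by fun_prop))).aestronglyMeasurable, ?_⟩
  have h : ∫⁻ v, ‖fockKernel α v z * (f v * (Real.exp (-α * ‖v‖ ^ 2) : ℂ))‖ₑ * gauss (α / 2) z
      < ⊤ := by
    simp only [enorm_reproducing_integrand]
    calc ∫⁻ v, ‖weighted α f v‖ₑ * gauss (α / 2) (z - v)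
        ≤ ∫⁻ v, A * gauss (α / 2) (v - z) := by
          refine lintegral_mono fun v => ?_
          rw [gauss_sub_comm]
          gcongr
          exact hA v
      _ = A * ∫⁻ v, gauss (α / 2) (v - z) :=
          lintegral_const_mul' _ _ ENNReal.coe_ne_top
      _ < ⊤ := ENNReal.mul_lt_top ENNReal.coe_lt_top
          (lintegral_gauss_ne_top (by positivity) z).lt_top
  rw [lintegral_mul_const' _ _ (gauss_ne_top _ _)] at h
  exact (ENNReal.lt_top_of_mul_ne_top_left h.ne (gauss_pos _ _).ne')

/-- With $v=z+u$ the reproducing integral becomes the Gaussian mean of the Weyl shift at $z$, whose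
value at $0$ is $f(z)$. -/
lemma weylShift_sub_mul (f : Cn n → ℂ) (z v : Cn n) :
    weylShift α f z (v - z) * (Real.exp (-α * ‖v - z‖ ^ 2) : ℂ) =
      fockKernel α v z * (f v * (Real.exp (-α * ‖v‖ ^ 2) : ℂ)) := by
  unfold weylShift fockKernel
  rw [add_sub_cancel, mul_assoc, mul_left_comm (Complex.exp _) (f v)]
  congr 1
  rw [Complex.ofReal_exp, Complex.ofReal_exp, ← Complex.exp_add, ← Complex.exp_add]
  congr 1
  have h : ((‖v - z‖ ^ 2 : ℝ) : ℂ) = inner ℂ (v - z) (v - z) := by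
    rw [inner_self_eq_norm_sq_to_K]; norm_cast
  have h1 : ((‖v‖ ^ 2 : ℝ) : ℂ) = inner ℂ v v := by
    rw [inner_self_eq_norm_sq_to_K]; norm_cast
  rw [Complex.ofReal_mul, Complex.ofReal_mul, h, h1, inner_sub_left, inner_sub_right,
    inner_sub_right]
  push_cast
  ring

/-- The reproducing formula for functions in `F^∞`. -/
lemma integral_reproducing (hα : 0 < α) {f : Cn n → ℂ} (hf : Differentiable ℂ f) {A : ℝ≥0}
    (hA : ∀ z, ‖weighted α f z‖ₑ ≤ A) (z : Cn n) :
    ∫ v, fockKernel α v z * (f v * (Real.exp (-α * ‖v‖ ^ 2) : ℂ)) =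
      ((Real.pi / α) ^ n : ℝ) * f z := by
  -- This Gaussian measure is circular with mass $(\pi/\alpha)^n$, so the mean value property yields
  -- the formula.
  set ρ : Measure (Cn n) := volume.withDensity (gauss α) with hρ
  have huniv : ρ Set.univ = ENNReal.ofReal ((Real.pi / α) ^ n) := by
    rw [hρ, withDensity_apply _ MeasurableSet.univ, Measure.restrict_univ, lintegral_gauss hα]
  have : IsFiniteMeasure ρ := ⟨by rw [huniv]; exact ENNReal.ofReal_lt_top⟩
  have hreal : ρ.real Set.univ = (Real.pi / α) ^ n := by
    rw [Measure.real, huniv, ENNReal.toReal_ofReal (by positivity)]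
  have hI := integrable_reproducing hα hf.continuous.measurable hA z
  have heq : ∀ v, fockKernel α v z * (f v * (Real.exp (-α * ‖v‖ ^ 2) : ℂ)) =
      (fun u => weylShift α f z u * (Real.exp (-α * ‖u‖ ^ 2) : ℂ)) (v - z) :=
    fun v => (weylShift_sub_mul f z v).symm
  simp only [heq] at hI ⊢
  have hI' := hI.comp_add_right z
  simp only [add_sub_cancel_right] at hI'
  rw [integral_sub_right_eq_self (fun u => weylShift α f z u * (Real.exp (-α * ‖u‖ ^ 2) : ℂ)) z]
  have hsm : ∀ u, weylShift α f z u * (Real.exp (-α * ‖u‖ ^ 2) : ℂ) =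
      (gauss α u).toReal • weylShift α f z u := fun u => by
    rw [gauss, ENNReal.toReal_ofReal (Real.exp_pos _).le, Complex.real_smul, mul_comm]
  simp only [hsm] at hI' ⊢
  have hlt : ∀ᵐ u : Cn n, gauss α u < ⊤ := Eventually.of_forall fun u => (gauss_ne_top _ u).lt_top
  rw [← integral_withDensity_eq_integral_toReal_smul (continuous_gauss α).measurable hlt,
    integral_eq_of_circular ρ (fun c hc => measurePreserving_unit_smul_withDensity hc α)
      (differentiable_weylShift hf z)
      ((integrable_withDensity_iff_integrable_smul' (continuous_gauss α).measurable hlt).2 hI'),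
    hreal]
  simp [weylShift]

lemma enorm_weighted_le_of_tendsto {F : ℕ → Cn n → ℂ} {g : Cn n → ℂ} {A : ℝ≥0}
    (hA : ∀ m z, ‖weighted α (F m) z‖ₑ ≤ A)
    (hg : ∀ z, Tendsto (fun m => F m z) atTop (𝓝 (g z))) (z : Cn n) : ‖weighted α g z‖ₑ ≤ A := by
  have : Tendsto (fun m => ‖weighted α (F m) z‖ₑ) atTop (𝓝 ‖weighted α g z‖ₑ) :=
    ((hg z).mul_const _).enorm
  exact le_of_tendsto' this fun m => hA m z

/-- Dominated convergence carries the reproducing formula over to the pointwise limit. The limit is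
then a superposition of kernels, hence entire; locally uniform convergence is not needed. -/
lemma differentiable_of_tendsto (hα : 0 < α) {F : ℕ → Cn n → ℂ} {g : Cn n → ℂ} {A : ℝ≥0}
    (hF : ∀ m, Differentiable ℂ (F m)) (hA : ∀ m z, ‖weighted α (F m) z‖ₑ ≤ A)
    (hg : ∀ z, Tendsto (fun m => F m z) atTop (𝓝 (g z))) : Differentiable ℂ g := by
  have hgm : Measurable g := measurable_of_tendsto_metrizable
    (fun m => (hF m).continuous.measurable) (tendsto_pi_nhds.2 hg)
  have hgA := enorm_weighted_le_of_tendsto hA hg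
  have hgI := integrable_reproducing hα hgm hgA
  have hrep : ∀ z, ∫ v, fockKernel α v z * (g v * (Real.exp (-α * ‖v‖ ^ 2) : ℂ)) =
      ((Real.pi / α) ^ n : ℝ) * g z := fun z => by
    -- The majorant comes from $Ae^{\alpha|v|^2/2}$, the extremal growth allowed by the hypothesis,
    -- whose weighted modulus is constantly $A$.
    have hone := integrable_reproducing hα (f := fun v => (A : ℂ) * Real.exp (α / 2 * ‖v‖ ^ 2))
      (by fun_prop) (A := A) (fun v => le_of_eq ?_) z
    · have hlim : Tendsto (fun m => ∫ v, fockKernel α v z *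
          (F m v * (Real.exp (-α * ‖v‖ ^ 2) : ℂ))) atTop
          (𝓝 (∫ v, fockKernel α v z * (g v * (Real.exp (-α * ‖v‖ ^ 2) : ℂ)))) := by
        refine tendsto_integral_of_dominated_convergence _
          (fun m => (integrable_reproducing hα (hF m).continuous.measurable (hA m) z).1)
          hone.norm (fun m => Eventually.of_forall fun v => ?_)
          (Eventually.of_forall fun v => ((hg v).mul_const _).const_mul _)
        have := norm_le_of_enorm_weighted_le (hA m v)
        rw [norm_mul, norm_mul, norm_mul, norm_mul]
        gcongr
        rw [norm_mul, Complex.norm_real, Complex.norm_real, Real.norm_of_nonneg A.coe_nonneg,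
          Real.norm_of_nonneg (Real.exp_pos _).le]
        exact this
      refine tendsto_nhds_unique hlim ?_
      simp only [fun m => integral_reproducing hα (hF m) (hA m) z]
      exact (hg z).const_mul _
    · rw [weighted, mul_assoc, ← Complex.ofReal_mul, ← Real.exp_add]
      simp [← ofReal_norm]
  have hc : (((Real.pi / α) ^ n : ℝ) : ℂ) ≠ 0 := by
    exact_mod_cast (by positivity : (Real.pi / α) ^ n ≠ 0)
  have hd := (differentiable_integral_fockKernel hα (μ := volume)
    (hgm.mul (by fun_prop)).aestronglyMeasurable hgI).const_mul (((Real.pi / α) ^ n : ℝ) : ℂ)⁻¹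
  have heq : g = fun z => (((Real.pi / α) ^ n : ℝ) : ℂ)⁻¹ *
      ∫ v, fockKernel α v z * (g v * (Real.exp (-α * ‖v‖ ^ 2) : ℂ)) := by
    ext z
    rw [hrep, ← mul_assoc, inv_mul_cancel₀ hc, one_mul]
  rw [heq]
  exact hd

/-- Montel's theorem for sequences bounded in `F^∞`, with pointwise convergence. -/
lemma exists_subseq_tendsto (hα : 0 < α) {F : ℕ → Cn n → ℂ} {A : ℝ≥0}
    (hF : ∀ m, Differentiable ℂ (F m)) (hA : ∀ m z, ‖weighted α (F m) z‖ₑ ≤ A) :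
    ∃ φ : ℕ → ℕ, StrictMono φ ∧ ∃ g : Cn n → ℂ, Differentiable ℂ g ∧
      (∀ z, ‖weighted α g z‖ₑ ≤ A) ∧ ∀ z, Tendsto (fun m => F (φ m) z) atTop (𝓝 (g z)) := by
  set B : Cn n → ℝ := fun z => A * Real.exp (α / 2 * ‖z‖ ^ 2) with hB
  have hbd : ∀ m z, ‖F m z‖ ≤ B z := fun m z => norm_le_of_enorm_weighted_le (hA m z)
  set d : ℕ → Cn n := TopologicalSpace.denseSeq (Cn n)
  -- Tychonoff compactness of a countable product of discs replaces the diagonal argument on a dense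
  -- sequence.
  have hK : IsCompact (Set.univ.pi fun k => Metric.closedBall (0 : ℂ) (B (d k))) :=
    isCompact_univ_pi fun k => isCompact_closedBall _ _
  obtain ⟨ℓ, -, φ, hφ, hlim⟩ := hK.tendsto_subseq (x := fun m k => F m (d k))
    (fun m => Set.mem_univ_pi.2 fun k => by simpa using hbd m (d k))
  rw [tendsto_pi_nhds] at hlim
  -- Equicontinuity from the Schwarz lemma: each $F_m$ maps $D(z,1)$ into the disc of radius $2M$
  -- about $F_m(z)$. The added 1 in the constant below only makes it positive.
  have hlip : ∀ z, ∃ L > 0, ∀ m, ∀ y ∈ Metric.ball z 1, dist (F m y) (F m z) ≤ L * dist y z := by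
    intro z
    set M : ℝ := A * Real.exp (α / 2 * (‖z‖ + 1) ^ 2) with hM
    have hM0 : 0 ≤ M := by positivity
    have hle : ∀ m, ∀ y ∈ Metric.ball z 1, ‖F m y‖ ≤ M := fun m y hy => by
      refine (hbd m y).trans ?_
      have : ‖y‖ ≤ ‖z‖ + 1 := by
        have := norm_sub_norm_le y z
        rw [Metric.mem_ball, dist_eq_norm] at hy
        linarith
      simp only [hB, hM]
      gcongr
    refine ⟨2 * M + 1, by positivity, fun m y hy => ?_⟩
    have := Complex.dist_le_div_mul_dist_of_mapsTo_ball (R₁ := 1) (R₂ := 2 * M)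
      (hF m).differentiableOn (fun x hx => ?_) hy
    · refine this.trans ?_
      rw [div_one]; gcongr; linarith
    · rw [Metric.mem_closedBall]
      refine (dist_le_norm_add_norm _ _).trans ?_
      have h1 := hle m x hx
      have h2 := hle m z (Metric.mem_ball_self one_pos)
      linarith
  have hcauchy : ∀ z, CauchySeq fun m => F (φ m) z := fun z => by
    obtain ⟨L, hL, hLip⟩ := hlip z
    refine Metric.cauchySeq_iff'.2 fun ε hε => ?_
    obtain ⟨k, hk⟩ := (TopologicalSpace.denseRange_denseSeq (Cn n)).exists_dist_lt z
      (ε := min 1 (ε / (3 * L))) (by positivity)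
    rw [dist_comm] at hk
    have hk1 : d k ∈ Metric.ball z 1 := hk.trans_le (min_le_left _ _)
    have hk2 : ∀ m, dist (F m (d k)) (F m z) < ε / 3 := fun m => by
      refine (hLip m _ hk1).trans_lt ?_
      calc L * dist (d k) z < L * (ε / (3 * L)) := by
            gcongr; exact hk.trans_le (min_le_right _ _)
        _ = ε / 3 := by field_simp
    obtain ⟨N, hN⟩ := Metric.cauchySeq_iff'.1 (hlim k).cauchySeq (ε / 3) (by positivity)
    refine ⟨N, fun m hm => ?_⟩
    calc dist (F (φ m) z) (F (φ N) z)
        ≤ dist (F (φ m) z) (F (φ m) (d k)) + dist (F (φ m) (d k)) (F (φ N) (d k)) +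
          dist (F (φ N) (d k)) (F (φ N) z) := dist_triangle4 _ _ _ _
      _ < ε / 3 + ε / 3 + ε / 3 := by
          gcongr
          · rw [dist_comm]; exact hk2 _
          · exact hN m hm
          · exact hk2 _
      _ = ε := by ring
  choose g hg using fun z => cauchySeq_tendsto_of_complete (hcauchy z)
  exact ⟨φ, hφ, g, differentiable_of_tendsto hα (fun m => hF _) (fun m => hA _) hg,
    enorm_weighted_le_of_tendsto (fun m => hA _) hg, hg⟩

end Holomorphy

-- The Toeplitz operator on its natural domain

section Toeplitz

variable {n : ℕ} {α : ℝ} {p : ℝ≥0∞} {μ : Measure (Cn n)}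

lemma fockNorm_const_mul (hp : p ≠ 0) (c : ℂ) {f : Cn n → ℂ} (hf : Continuous f) :
    fockNorm α p (fun z => c * f z) = ‖c‖ₑ * fockNorm α p f := by
  rw [fockNorm_eq hp (by fun_prop), fockNorm_eq hp hf, weighted_const_mul, eLpNorm_const_smul,
    mul_left_comm]

lemma fockNorm_sub_le (hp : 1 ≤ p) {f g : Cn n → ℂ} (hf : Continuous f) (hg : Continuous g) :
    fockNorm α p (fun z => f z - g z) ≤ fockNorm α p f + fockNorm α p g := by
  have hp0 : p ≠ 0 := (one_pos.trans_le hp).ne'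
  rw [fockNorm_eq hp0 (by fun_prop), fockNorm_eq hp0 hf, fockNorm_eq hp0 hg, weighted_sub,
    ← mul_add]
  gcongr
  exact eLpNorm_sub_le (continuous_weighted hf).aestronglyMeasurable
    (continuous_weighted hg).aestronglyMeasurable hp

lemma MemFock.const_mul (hp : p ≠ 0) (c : ℂ) {f : Cn n → ℂ} (hf : MemFock α p f) :
    MemFock α p fun z => c * f z :=
  ⟨hf.1.const_mul c, by
    rw [fockNorm_const_mul hp c hf.1.continuous]
    exact ENNReal.mul_lt_top enorm_lt_top hf.2⟩

lemma MemFock.sub (hp : 1 ≤ p) {f g : Cn n → ℂ} (hf : MemFock α p f) (hg : MemFock α p g) :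
    MemFock α p fun z => f z - g z :=
  ⟨hf.1.sub hg.1, (fockNorm_sub_le hp hf.1.continuous hg.1.continuous).trans_lt
    (ENNReal.add_lt_top.2 ⟨hf.2, hg.2⟩)⟩

lemma MemFock.memLp (hα : 0 < α) (hp : p ≠ 0) {f : Cn n → ℂ} (hf : MemFock α p f) :
    MemLp (weighted α f) p volume := by
  refine ⟨(continuous_weighted hf.1.continuous).aestronglyMeasurable, ?_⟩
  have := hf.2
  rw [fockNorm_eq hp hf.1.continuous] at this
  exact ENNReal.lt_top_of_mul_ne_top_right this.ne (fockConst_pos hα hp).ne'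

lemma MemFock.of_memLp (hp : p ≠ 0) {f : Cn n → ℂ} (hf : Differentiable ℂ f)
    (h : MemLp (weighted α f) p volume) : MemFock α p f := by
  refine ⟨hf, ?_⟩
  rw [fockNorm_eq hp hf.continuous]
  exact ENNReal.mul_lt_top fockConst_ne_top.lt_top h.2

lemma MemFock.sum (hα : 0 < α) (hp : p ≠ 0) {ι : Type*} (s : Finset ι) {f : ι → Cn n → ℂ}
    (hf : ∀ i ∈ s, MemFock α p (f i)) : MemFock α p fun z => ∑ i ∈ s, f i z := by
  refine MemFock.of_memLp hp (Differentiable.fun_sum fun i hi => (hf i hi).1) ?_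
  have : weighted α (fun z => ∑ i ∈ s, f i z) = fun z => ∑ i ∈ s, weighted α (f i) z := by
    ext z; simp [weighted, Finset.sum_mul]
  rw [this]
  exact memLp_finsetSum s fun i hi => (hf i hi).memLp hα hp

lemma toeplitzIntegrand_eq (f : Cn n → ℂ) (z w : Cn n) :
    toeplitzIntegrand α f z w = fockKernel α w z * (f w * (Real.exp (-α * ‖w‖ ^ 2) : ℂ)) :=
  mul_assoc _ _ _

lemma enorm_toeplitzIntegrand (f : Cn n → ℂ) (z w : Cn n) :
    ‖toeplitzIntegrand α f z w‖ₑ * gauss (α / 2) z =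
      ‖weighted α f w‖ₑ * gauss (α / 2) (z - w) := by
  rw [toeplitzIntegrand_eq, enorm_reproducing_integrand]

lemma continuous_toeplitzIntegrand {f : Cn n → ℂ} (hf : Continuous f) (z : Cn n) :
    Continuous (toeplitzIntegrand α f z) := by
  unfold toeplitzIntegrand; fun_prop

lemma integrable_toeplitzIntegrand_iff {f : Cn n → ℂ} (hf : Continuous f) (z : Cn n) :
    Integrable (toeplitzIntegrand α f z) μ ↔
      ∫⁻ w, ‖weighted α f w‖ₑ * gauss (α / 2) (z - w) ∂μ < ⊤ := by
  have h : ∫⁻ w, ‖weighted α f w‖ₑ * gauss (α / 2) (z - w) ∂μ =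
      (∫⁻ w, ‖toeplitzIntegrand α f z w‖ₑ ∂μ) * gauss (α / 2) z := by
    simp only [← enorm_toeplitzIntegrand]
    rw [lintegral_mul_const' _ _ (gauss_ne_top _ _)]
  rw [h]
  refine ⟨fun hi => ENNReal.mul_lt_top hi.2 (gauss_ne_top _ _).lt_top, fun hi =>
    ⟨(continuous_toeplitzIntegrand hf z).aestronglyMeasurable,
      ENNReal.lt_top_of_mul_ne_top_left hi.ne (gauss_pos _ _).ne'⟩⟩

/-- A bounded embedding into $L^1(\sigma_1)$ makes the natural domain everything: the kernel
contributes, after weighting in $z$, only a Gaussian factor at most 1. -/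
lemma InToeplitzDomain.of_lintegral_lt_top (hα : 0 < α) {f : Cn n → ℂ} (hf : MemFock α p f)
    (h : ∫⁻ w, ‖weighted α f w‖ₑ ∂μ < ⊤) : InToeplitzDomain α μ p f := by
  refine ⟨hf, fun z => (integrable_toeplitzIntegrand_iff hf.1.continuous z).2 ?_⟩
  refine lt_of_le_of_lt (lintegral_mono fun w => ?_) h
  exact mul_le_of_le_one_right' (gauss_le_one (by positivity) _)

lemma InToeplitzDomain.differentiable (hα : 0 < α) {f : Cn n → ℂ}
    (hf : InToeplitzDomain α μ p f) : Differentiable ℂ (toeplitz α μ f) := by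
  have hc := hf.1.1.continuous
  have := differentiable_integral_fockKernel hα (μ := μ)
    (h := fun w => f w * (Real.exp (-α * ‖w‖ ^ 2) : ℂ))
    (Continuous.aestronglyMeasurable (by fun_prop))
    (fun z => (hf.2 z).congr (Eventually.of_forall (toeplitzIntegrand_eq f z)))
  have heq : toeplitz α μ f =
      fun z => ∫ w, fockKernel α w z * (f w * (Real.exp (-α * ‖w‖ ^ 2) : ℂ)) ∂μ := by
    ext z
    exact integral_congr_ae (Eventually.of_forall (toeplitzIntegrand_eq f z))
  rw [heq]
  exact this

lemma toeplitzIntegrand_const_mul (c : ℂ) (f : Cn n → ℂ) (z : Cn n) :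
    toeplitzIntegrand α (fun w => c * f w) z = fun w => c * toeplitzIntegrand α f z w := by
  ext w; unfold toeplitzIntegrand; ring

lemma InToeplitzDomain.const_mul (hp : p ≠ 0) (c : ℂ) {f : Cn n → ℂ}
    (hf : InToeplitzDomain α μ p f) : InToeplitzDomain α μ p fun z => c * f z :=
  ⟨hf.1.const_mul hp c, fun z => by
    rw [toeplitzIntegrand_const_mul]; exact (hf.2 z).const_mul c⟩

lemma toeplitz_const_mul (c : ℂ) (f : Cn n → ℂ) :
    toeplitz α μ (fun z => c * f z) = fun z => c * toeplitz α μ f z := by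
  ext z
  unfold toeplitz
  rw [toeplitzIntegrand_const_mul, integral_const_mul]

lemma toeplitzIntegrand_sum {ι : Type*} (s : Finset ι) (f : ι → Cn n → ℂ) (z : Cn n) :
    toeplitzIntegrand α (fun w => ∑ i ∈ s, f i w) z =
      fun w => ∑ i ∈ s, toeplitzIntegrand α (f i) z w := by
  ext w; simp only [toeplitzIntegrand, Finset.mul_sum, Finset.sum_mul]

lemma InToeplitzDomain.sum (hα : 0 < α) (hp : p ≠ 0) {ι : Type*} (s : Finset ι)
    {f : ι → Cn n → ℂ} (hf : ∀ i ∈ s, InToeplitzDomain α μ p (f i)) :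
    InToeplitzDomain α μ p fun z => ∑ i ∈ s, f i z :=
  ⟨MemFock.sum hα hp s fun i hi => (hf i hi).1, fun z => by
    rw [toeplitzIntegrand_sum]; exact integrable_finsetSum _ fun i hi => (hf i hi).2 z⟩

lemma toeplitz_sum {ι : Type*} (s : Finset ι) {f : ι → Cn n → ℂ}
    (hf : ∀ i ∈ s, InToeplitzDomain α μ p (f i)) :
    toeplitz α μ (fun z => ∑ i ∈ s, f i z) = fun z => ∑ i ∈ s, toeplitz α μ (f i) z := by
  ext z
  unfold toeplitz
  rw [toeplitzIntegrand_sum, integral_finsetSum _ fun i hi => (hf i hi).2 z]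

lemma InToeplitzDomain.sub (hp : 1 ≤ p) {f g : Cn n → ℂ} (hf : InToeplitzDomain α μ p f)
    (hg : InToeplitzDomain α μ p g) : InToeplitzDomain α μ p fun z => f z - g z :=
  ⟨hf.1.sub hp hg.1, fun z => by
    refine ((hf.2 z).sub (hg.2 z)).congr (Eventually.of_forall fun w => ?_)
    simp [toeplitzIntegrand]; ring⟩

lemma toeplitz_sub {f g : Cn n → ℂ} (hf : InToeplitzDomain α μ p f)
    (hg : InToeplitzDomain α μ p g) :
    toeplitz α μ (fun z => f z - g z) = fun z => toeplitz α μ f z - toeplitz α μ g z := by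
  ext z
  unfold toeplitz
  rw [← integral_sub (hf.2 z) (hg.2 z)]
  congr 1 with w
  simp [toeplitzIntegrand]; ring

/-- Up to the factor $e^{-\alpha|z|^2}$, admissibility says precisely that the Berezin transform of
$\mu$ is finite. -/
lemma Admissible.lintegral_gauss_lt_top (hμ : Admissible α μ) (z : Cn n) :
    ∫⁻ w, gauss α (z - w) ∂μ < ⊤ := by
  have h : ∀ w, gauss α (z - w) = ‖fockKernel α w z‖ₑ ^ 2 *
      ENNReal.ofReal (Real.exp (-α * ‖w‖ ^ 2)) * gauss α z := fun w => by
    have h1 : gauss α (z - w) = gauss (α / 2) (z - w) * gauss (α / 2) (z - w) := by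
      rw [gauss_mul, add_halves]
    have h2 : ENNReal.ofReal (Real.exp (-α * ‖w‖ ^ 2)) =
        ‖(Real.exp (-(α / 2) * ‖w‖ ^ 2) : ℂ)‖ₑ * ‖(Real.exp (-(α / 2) * ‖w‖ ^ 2) : ℂ)‖ₑ := by
      rw [← ofReal_norm, Complex.norm_real, Real.norm_of_nonneg (Real.exp_pos _).le,
        ← ENNReal.ofReal_mul (Real.exp_pos _).le, ← Real.exp_add]
      congr 2; ring
    have h3 : gauss α z = gauss (α / 2) z * gauss (α / 2) z := by rw [gauss_mul, add_halves]
    rw [h1, h2, h3, ← enorm_weighted_normKernel, enorm_weighted, normKernel, enorm_mul]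
    ring
  simp only [h]
  rw [lintegral_mul_const' _ _ (gauss_ne_top _ _)]
  exact ENNReal.mul_lt_top (hμ z) (gauss_ne_top _ _).lt_top

lemma measure_ball_le_lintegral_gauss (ν : Measure (Cn n)) {c r : ℝ} (hc : 0 ≤ c) (a : Cn n) :
    ENNReal.ofReal (Real.exp (-c * r ^ 2)) * ν (Metric.ball a r) ≤ ∫⁻ w, gauss c (a - w) ∂ν := by
  refine le_trans ?_ (setLIntegral_le_lintegral (Metric.ball a r) _)
  rw [← setLIntegral_const]
  refine setLIntegral_mono' Metric.isOpen_ball.measurableSet fun w hw => ?_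
  refine le_gauss_of_norm_le hc ?_
  rw [← dist_eq_norm, dist_comm]
  exact (Metric.mem_ball.1 hw).le

lemma Admissible.measure_ball_lt_top (hα : 0 < α) (hμ : Admissible α μ) (a : Cn n) (r : ℝ) :
    μ (Metric.ball a r) < ⊤ :=
  ENNReal.lt_top_of_mul_ne_top_right
    ((measure_ball_le_lintegral_gauss μ hα.le a).trans_lt (hμ.lintegral_gauss_lt_top a)).ne
    (by simp [Real.exp_pos])

/-- Provides the s-finiteness of $\mu$ behind each exchange of integrals. -/
lemma Admissible.isLocallyFiniteMeasure (hα : 0 < α) (hμ : Admissible α μ) :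
    IsLocallyFiniteMeasure μ :=
  ⟨fun a => ⟨Metric.ball a 1, Metric.ball_mem_nhds a one_pos, hμ.measure_ball_lt_top hα a 1⟩⟩

/-- The product of the two half-exponent Gaussians, centred at $a$ and $z$, is at most the sum of
their squares, and each square has finite integral by admissibility. -/
lemma Admissible.inToeplitzDomain_normKernel (hα : 0 < α) (hp : p ≠ 0) (hμ : Admissible α μ)
    (a : Cn n) : InToeplitzDomain α μ p (normKernel α a) := by
  refine ⟨memFock_normKernel hα hp a, fun z =>
    (integrable_toeplitzIntegrand_iff (differentiable_normKernel a).continuous z).2 ?_⟩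
  simp only [enorm_weighted_normKernel]
  refine lt_of_le_of_lt (lintegral_mono (g := fun w => gauss α (a - w) + gauss α (z - w))
    fun w => ?_) ?_
  · rw [gauss_sub_comm _ w a]
    have h : ∀ x : Cn n, gauss α x = gauss (α / 2) x * gauss (α / 2) x := fun x => by
      rw [gauss_mul, add_halves]
    simp only [h]
    rcases le_total (gauss (α / 2) (a - w)) (gauss (α / 2) (z - w)) with hle | hle
    · exact (mul_le_mul' hle le_rfl).trans le_add_self
    · exact (mul_le_mul' le_rfl hle).trans le_self_add
  · rw [lintegral_add_left (by fun_prop)]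
    exact ENNReal.add_lt_top.2 ⟨hμ.lintegral_gauss_lt_top a, hμ.lintegral_gauss_lt_top z⟩

/-- The value of `T_μ k_a` at `a` is the Berezin transform of `μ`. -/
lemma enorm_weighted_toeplitz_normKernel (hμ : Admissible α μ) (a : Cn n) :
    ‖weighted α (toeplitz α μ (normKernel α a)) a‖ₑ = ∫⁻ w, gauss α (a - w) ∂μ := by
  have h : ∀ w, toeplitzIntegrand α (normKernel α a) a w * (Real.exp (-(α / 2) * ‖a‖ ^ 2) : ℂ) =
      (Real.exp (-α * ‖a - w‖ ^ 2) : ℂ) := fun w => by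
    rw [toeplitzIntegrand, normKernel, fockKernel, fockKernel, Complex.ofReal_exp,
      Complex.ofReal_exp, Complex.ofReal_exp, ← Complex.exp_add, ← Complex.exp_add,
      ← Complex.exp_add, ← Complex.exp_add]
    congr 1
    have h1 : ∀ v : Cn n, ((‖v‖ ^ 2 : ℝ) : ℂ) = inner ℂ v v := fun v => by
      rw [inner_self_eq_norm_sq_to_K]; norm_cast
    simp only [Complex.ofReal_mul, h1, inner_sub_left, inner_sub_right]
    push_cast
    ring
  rw [weighted, toeplitz, ← integral_mul_const]
  simp only [h]
  rw [integral_complex_ofReal, ← ofReal_norm, Complex.norm_real, Real.norm_of_nonneg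
    (integral_nonneg fun _ => (Real.exp_pos _).le), ofReal_integral_eq_lintegral_ofReal]
  · rfl
  · refine ⟨Continuous.aestronglyMeasurable (by fun_prop), ?_⟩
    have := hμ.lintegral_gauss_lt_top a
    refine lt_of_le_of_lt (lintegral_mono fun w => ?_) this
    rw [← ofReal_norm, Real.norm_of_nonneg (Real.exp_pos _).le]; rfl
  · exact Eventually.of_forall fun _ => (Real.exp_pos _).le

lemma enorm_weighted_toeplitz_le {f : Cn n → ℂ} (z : Cn n) :
    ‖weighted α (toeplitz α μ f) z‖ₑ ≤ ∫⁻ w, ‖weighted α f w‖ₑ * gauss (α / 2) (z - w) ∂μ := by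
  rw [enorm_weighted, toeplitz]
  refine (mul_le_mul_left (enorm_integral_le_lintegral_enorm _) _).trans (le_of_eq ?_)
  rw [← lintegral_mul_const' _ _ (gauss_ne_top _ _)]
  simp only [enorm_toeplitzIntegrand]

/-- `T_μ` maps `L¹(σ₁)` into `F^p`. -/
lemma exists_fockNorm_toeplitz_le (n : ℕ) (α : ℝ) (hα : 0 < α) {s : ℝ≥0∞} (hs : 1 ≤ s) :
    ∃ C : ℝ≥0, 0 < C ∧ ∀ μ : Measure (Cn n), SFinite μ → ∀ (p : ℝ≥0∞) (f : Cn n → ℂ),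
      InToeplitzDomain α μ p f →
        fockNorm α s (toeplitz α μ f) ≤ C * ∫⁻ w, ‖weighted α f w‖ₑ ∂μ := by
  -- Only the target $\mathcal F^1$ needs work; there Tonelli integrates the Gaussian in $z$ to a
  -- constant.
  obtain ⟨C, hC, h⟩ := exists_fockNorm_le_fockNorm_one n α hα hs
  set D : ℝ≥0∞ := fockConst n α 1 * ENNReal.ofReal ((Real.pi / (α / 2)) ^ n) with hD
  have hDt : D ≠ ⊤ := ENNReal.mul_ne_top fockConst_ne_top ENNReal.ofReal_ne_top
  have hD0 : D ≠ 0 := mul_ne_zero (fockConst_pos hα one_ne_zero).ne'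
    (ENNReal.ofReal_pos.2 (by positivity)).ne'
  refine ⟨C * D.toNNReal, mul_pos hC (ENNReal.toNNReal_pos hD0 hDt), fun μ _ p f hf => ?_⟩
  have hd := hf.differentiable hα
  refine (h _ hd).trans ?_
  rw [ENNReal.coe_mul, ENNReal.coe_toNNReal hDt, mul_assoc, fockNorm_eq one_ne_zero hd.continuous,
    eLpNorm_one_eq_lintegral_enorm, hD, mul_assoc (fockConst n α 1)]
  gcongr
  have hfc := continuous_weighted (α := α) hf.1.1.continuous
  calc ∫⁻ z, ‖weighted α (toeplitz α μ f) z‖ₑ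
      ≤ ∫⁻ z, ∫⁻ w, ‖weighted α f w‖ₑ * gauss (α / 2) (z - w) ∂μ :=
        lintegral_mono fun z => enorm_weighted_toeplitz_le z
    _ = ∫⁻ w, (∫⁻ z, ‖weighted α f w‖ₑ * gauss (α / 2) (z - w)) ∂μ := by
        refine lintegral_lintegral_swap (Measurable.aemeasurable ?_)
        exact (hfc.enorm.measurable.comp measurable_snd).mul
          ((continuous_gauss _).measurable.comp (measurable_fst.sub measurable_snd))
    _ = ∫⁻ w, ENNReal.ofReal ((Real.pi / (α / 2)) ^ n) * ‖weighted α f w‖ₑ ∂μ := by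
        refine lintegral_congr fun w => ?_
        rw [lintegral_const_mul' _ _ enorm_ne_top, lintegral_gauss_sub (by positivity), mul_comm]
    _ = _ := lintegral_const_mul' _ _ ENNReal.ofReal_ne_top

end Toeplitz

-- Operator norms and their homogeneity

section OperatorNorms

variable {n : ℕ} {α : ℝ} {p : ℝ≥0∞} {μ : Measure (Cn n)}

/-- Normalization of $f$, done once for the Toeplitz and the embedding norm. A zero norm needs
separate care because $S$ may be infinite while $S\cdot0=0$; entire functions of norm zero vanish
identically. -/
lemma le_mul_fockNorm_of_homogeneous (hα : 0 < α) (hp : 1 ≤ p) {P : (Cn n → ℂ) → Prop}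
    {Φ : (Cn n → ℂ) → ℝ≥0∞} {S : ℝ≥0∞} (hS : ∀ f, P f → fockNorm α p f ≤ 1 → Φ f ≤ S)
    (hmem : ∀ f, P f → MemFock α p f) (hP : ∀ (c : ℂ) f, P f → P fun z => c * f z)
    (hΦ : ∀ (c : ℂ) f, P f → Φ (fun z => c * f z) = ‖c‖ₑ * Φ f) {f : Cn n → ℂ} (hf : P f) :
    Φ f ≤ S * fockNorm α p f := by
  have hp0 : p ≠ 0 := (one_pos.trans_le hp).ne'
  have hm := hmem f hf
  rcases eq_or_ne (fockNorm α p f) 0 with h0 | h0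
  · have hz := eq_zero_of_fockNorm_eq_zero hα hp hm.1 h0
    have hfz : f = fun z => 0 * f z := by ext z; simp [hz]
    have : Φ f = 0 := by
      rw [hfz, hΦ 0 f hf]; simp
    rw [this]; exact zero_le
  · set N := fockNorm α p f with hN
    have hNt : N ≠ ⊤ := hm.2.ne
    set c : ℂ := ((N.toReal⁻¹ : ℝ) : ℂ) with hc
    have hcN : ‖c‖ₑ = N⁻¹ := by
      have hpos := ENNReal.toReal_pos h0 hNt
      rw [hc, ← ofReal_norm, Complex.norm_real, Real.norm_of_nonneg (by positivity),
        ENNReal.ofReal_inv_of_pos hpos, ENNReal.ofReal_toReal hNt]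
    have h1 := hS _ (hP c f hf) (by
      rw [fockNorm_const_mul hp0 c hm.1.continuous, hcN, ← hN, ENNReal.inv_mul_cancel h0 hNt])
    rw [hΦ c f hf, hcN, mul_comm, ← div_eq_mul_inv] at h1
    exact (ENNReal.div_le_iff h0 hNt).1 h1

lemma fockNorm_toeplitz_le_toeplitzNorm (hα : 0 < α) (hp : 1 ≤ p) {s : ℝ≥0∞} (hs : s ≠ 0)
    {f : Cn n → ℂ} (hf : InToeplitzDomain α μ p f) :
    fockNorm α s (toeplitz α μ f) ≤ toeplitzNorm α μ p s * fockNorm α p f := by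
  refine le_mul_fockNorm_of_homogeneous hα hp (P := InToeplitzDomain α μ p)
    (Φ := fun f => fockNorm α s (toeplitz α μ f)) (fun g hg h1 => ?_) (fun g hg => hg.1)
    (fun c g hg => hg.const_mul (one_pos.trans_le hp).ne' c) (fun c g hg => ?_) hf
  · exact le_iSup₂_of_le g hg (le_iSup_of_le h1 le_rfl)
  · rw [toeplitz_const_mul, fockNorm_const_mul hs c (hg.differentiable hα).continuous]

lemma eLpNorm_weighted_le_embeddingNorm (hα : 0 < α) (hp : 1 ≤ p) {q : ℝ} (hq : 0 < q)
    {f : Cn n → ℂ} (hf : MemFock α p f) :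
    eLpNorm (weighted α f) (ENNReal.ofReal q) μ ≤ embeddingNorm α μ p q * fockNorm α p f := by
  refine le_mul_fockNorm_of_homogeneous hα hp (P := MemFock α p)
    (Φ := fun f => eLpNorm (weighted α f) (ENNReal.ofReal q) μ) (fun g hg h1 => ?_)
    (fun g hg => hg) (fun c g hg => hg.const_mul (one_pos.trans_le hp).ne' c)
    (fun c g hg => ?_) hf
  · rw [← eLpNorm_sigmaMeasure μ hq]
    exact le_iSup₂_of_le g hg (le_iSup_of_le h1 le_rfl)
  · rw [weighted_const_mul, eLpNorm_const_smul]

lemma lintegral_weighted_le_embeddingNorm (hα : 0 < α) (hp : 1 ≤ p)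
    {f : Cn n → ℂ} (hf : MemFock α p f) :
    ∫⁻ z, ‖weighted α f z‖ₑ ∂μ ≤ embeddingNorm α μ p 1 * fockNorm α p f := by
  have := eLpNorm_weighted_le_embeddingNorm (μ := μ) hα hp one_pos hf
  rwa [ENNReal.ofReal_one, eLpNorm_one_eq_lintegral_enorm] at this

lemma eLpNorm_weighted_rpow {q : ℝ} (hq : 0 < q) (f : Cn n → ℂ) :
    eLpNorm (weighted α f) (ENNReal.ofReal q) μ ^ q = ∫⁻ z, ‖weighted α f z‖ₑ ^ q ∂μ := by
  rw [eLpNorm_eq_lintegral_rpow_enorm_toReal (by simpa using hq) ENNReal.ofReal_ne_top,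
    ENNReal.toReal_ofReal hq.le, one_div, ENNReal.rpow_inv_rpow hq.ne']

lemma embeddingNorm_rpow_le {q : ℝ} (hq : 0 < q) {S : ℝ≥0∞}
    (h : ∀ f, MemFock α p f → fockNorm α p f ≤ 1 → ∫⁻ z, ‖weighted α f z‖ₑ ^ q ∂μ ≤ S) :
    embeddingNorm α μ p q ^ q ≤ S := by
  rw [← ENNReal.le_rpow_inv_iff hq]
  refine iSup₂_le fun f hf => iSup_le fun h1 => ?_
  rw [ENNReal.le_rpow_inv_iff hq, eLpNorm_sigmaMeasure μ hq, eLpNorm_weighted_rpow hq]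
  exact h f hf h1

lemma toeplitzBounded_iff (hα : 0 < α) (hp : 1 ≤ p) {s : ℝ≥0∞} (hs : s ≠ 0) :
    ToeplitzBounded α μ p s ↔ toeplitzNorm α μ p s < ⊤ := by
  refine ⟨fun ⟨C, hC⟩ => ?_, fun h => ?_⟩
  · refine lt_of_le_of_lt (iSup₂_le fun f hf => iSup_le fun h1 => ?_) (ENNReal.coe_lt_top (r := C))
    exact (hC f hf).2.trans (mul_le_of_le_one_right' h1)
  · refine ⟨(toeplitzNorm α μ p s).toNNReal, fun f hf => ?_⟩
    have := fockNorm_toeplitz_le_toeplitzNorm hα hp hs hf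
    rw [ENNReal.coe_toNNReal h.ne]
    exact ⟨⟨hf.differentiable hα, this.trans_lt (ENNReal.mul_lt_top h hf.1.2)⟩, this⟩

lemma isFockCarleson_iff (hα : 0 < α) (hp : 1 ≤ p) {q : ℝ} (hq : 0 < q) :
    IsFockCarleson α μ p q ↔ embeddingNorm α μ p q < ⊤ := by
  unfold IsFockCarleson
  simp only [← enorm_weighted_rpow _ _ hq.le]
  refine ⟨fun ⟨C, hC⟩ => ?_, fun h => ?_⟩
  · have : embeddingNorm α μ p q ^ q ≤ C := embeddingNorm_rpow_le hq fun f hf h1 =>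
      (hC f hf).trans (mul_le_of_le_one_right' (ENNReal.rpow_le_one h1 hq.le))
    exact (ENNReal.rpow_lt_top_iff_of_pos hq).1 (this.trans_lt ENNReal.coe_lt_top)
  · refine ⟨(embeddingNorm α μ p q ^ q).toNNReal, fun f hf => ?_⟩
    rw [ENNReal.coe_toNNReal ((ENNReal.rpow_lt_top_iff_of_pos hq).2 h).ne,
      ← ENNReal.mul_rpow_of_nonneg _ _ hq.le, ← eLpNorm_weighted_rpow hq]
    gcongr
    exact eLpNorm_weighted_le_embeddingNorm hα hp hq hf

lemma exists_toeplitzNorm_le_embeddingNorm (n : ℕ) (α : ℝ) (hα : 0 < α) {p s : ℝ≥0∞}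
    (hp : 1 ≤ p) (hs : 1 ≤ s) :
    ∃ C : ℝ≥0, 0 < C ∧ ∀ μ : Measure (Cn n), SFinite μ →
      toeplitzNorm α μ p s ≤ C * embeddingNorm α μ p 1 := by
  obtain ⟨C, hC, h⟩ := exists_fockNorm_toeplitz_le n α hα hs
  refine ⟨C, hC, fun μ hμ => iSup₂_le fun f hf => iSup_le fun h1 => ?_⟩
  refine (h μ hμ p f hf).trans ?_
  gcongr
  exact (lintegral_weighted_le_embeddingNorm hα hp hf.1).trans (mul_le_of_le_one_right' h1)

end OperatorNorms

-- Source space $\mathcal F^1$: comparison with the masses of unit balls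

/-- The supremum of the masses of the unit balls. -/
noncomputable def ballSup {n : ℕ} (μ : Measure (Cn n)) : ℝ≥0∞ := ⨆ a, μ (Metric.ball a 1)

section BallSup

variable {n : ℕ} {α : ℝ} {p : ℝ≥0∞} {μ : Measure (Cn n)}

/-- Integrate the local estimate against $\mu$ and exchange: as $z\in D(w,1)$ iff $w\in D(z,1)$, the
inner integral becomes $\mu(D(z,1))$. -/
lemma exists_lintegral_weighted_le_ballSup (n : ℕ) (α : ℝ) (hα : 0 < α) :
    ∃ C : ℝ≥0, 0 < C ∧ ∀ μ : Measure (Cn n), SFinite μ → ∀ f : Cn n → ℂ, Differentiable ℂ f →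
      ∫⁻ z, ‖weighted α f z‖ₑ ∂μ ≤ C * ballSup μ * fockNorm α 1 f := by
  obtain ⟨C, hC, h⟩ := exists_enorm_weighted_le_lintegral_ball n α hα one_pos
  have h1 := (fockConst_pos (n := n) hα one_ne_zero).ne'
  have ht := fockConst_ne_top (n := n) (α := α) (p := 1)
  have hi := ENNReal.inv_ne_top.2 h1
  refine ⟨C * (fockConst n α 1)⁻¹.toNNReal, mul_pos hC (ENNReal.toNNReal_pos
    (ENNReal.inv_ne_zero.2 ht) hi), fun μ _ f hf => ?_⟩
  have hW := (continuous_weighted (α := α) hf.continuous).enorm.measurable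
  rw [fockNorm_eq one_ne_zero hf.continuous, eLpNorm_one_eq_lintegral_enorm, ENNReal.coe_mul,
    ENNReal.coe_toNNReal hi]
  have hset : MeasurableSet {x : Cn n × Cn n | dist x.2 x.1 < 1} :=
    (isOpen_lt (by fun_prop) continuous_const).measurableSet
  calc ∫⁻ w, ‖weighted α f w‖ₑ ∂μ
      ≤ ∫⁻ w, C * (∫⁻ z, (Metric.ball w 1).indicator (fun z => ‖weighted α f z‖ₑ) z) ∂μ := by
        refine lintegral_mono fun w => (h f hf w).trans ?_
        rw [lintegral_indicator Metric.isOpen_ball.measurableSet]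
    _ = C * ∫⁻ w, (∫⁻ z, (Metric.ball w 1).indicator (fun z => ‖weighted α f z‖ₑ) z) ∂μ :=
        lintegral_const_mul' _ _ ENNReal.coe_ne_top
    _ = C * ∫⁻ z, (∫⁻ w, (Metric.ball w 1).indicator (fun z => ‖weighted α f z‖ₑ) z ∂μ) := by
        rw [lintegral_lintegral_swap]
        have : (Function.uncurry fun w z : Cn n =>
            (Metric.ball w 1).indicator (fun z => ‖weighted α f z‖ₑ) z) =
            {x : Cn n × Cn n | dist x.2 x.1 < 1}.indicator fun x => ‖weighted α f x.2‖ₑ := by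
          ext ⟨w, z⟩
          classical
          simp [Set.indicator_apply]
        rw [this]
        exact ((hW.comp measurable_snd).indicator hset).aemeasurable
    _ ≤ C * ∫⁻ z, ballSup μ * ‖weighted α f z‖ₑ := by
        gcongr with z
        have : ∀ w, (Metric.ball w 1).indicator (fun z => ‖weighted α f z‖ₑ) z =
            (Metric.ball z 1).indicator (fun _ => ‖weighted α f z‖ₑ) w := fun w => by
          classical
          simp [Set.indicator_apply, dist_comm]
        rw [lintegral_congr this, lintegral_indicator_const Metric.isOpen_ball.measurableSet, mul_comm]
        gcongr
        exact le_iSup (fun a => μ (Metric.ball a 1)) z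
    _ = C * (ballSup μ * ∫⁻ z, ‖weighted α f z‖ₑ) := by
        rw [lintegral_const_mul _ hW]
    _ = _ := by
        calc _ = C * ballSup μ * ((fockConst n α 1)⁻¹ * fockConst n α 1) *
              ∫⁻ z, ‖weighted α f z‖ₑ := by
              rw [ENNReal.inv_mul_cancel h1 ht]; ring
          _ = _ := by ring

/-- On the unit ball of $\mathcal F^1$ the weighted moduli are bounded by a fixed $D$, which reduces
$q$ to 1. The supremum enters linearly, whence the $q$-th power of the norm. -/
lemma exists_embeddingNorm_rpow_le_ballSup (n : ℕ) (α : ℝ) (hα : 0 < α) {q : ℝ} (hq : 1 ≤ q) :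
    ∃ C : ℝ≥0, 0 < C ∧ ∀ μ : Measure (Cn n), SFinite μ →
      embeddingNorm α μ 1 q ^ q ≤ C * ballSup μ := by
  obtain ⟨C, hC, h⟩ := exists_lintegral_weighted_le_ballSup n α hα
  obtain ⟨D, hD, hpt⟩ := exists_enorm_weighted_le_fockNorm n α hα le_rfl
  refine ⟨D ^ (q - 1) * C, mul_pos (NNReal.rpow_pos hD) hC, fun μ hμ =>
    embeddingNorm_rpow_le (by linarith) fun f hf h1 => ?_⟩
  have hA : ∀ z, ‖weighted α f z‖ₑ ≤ D := fun z =>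
    (hpt f hf.1 z).trans (mul_le_of_le_one_right' h1)
  refine (lintegral_enorm_rpow_le hq
    (continuous_weighted hf.1.continuous).enorm.measurable.aemeasurable hA).trans ?_
  rw [ENNReal.coe_mul, ENNReal.coe_rpow_of_nonneg _ (by linarith), mul_assoc]
  gcongr
  exact (h μ hμ f hf.1).trans (mul_le_of_le_one_right' h1)

lemma measure_ball_le_lintegral_normKernel (ν : Measure (Cn n)) (hα : 0 < α) {q : ℝ}
    (hq : 0 < q) (a : Cn n) :
    ν (Metric.ball a 1) ≤ ENNReal.ofReal (Real.exp (α / 2 * q)) *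
      ∫⁻ z, ‖weighted α (normKernel α a) z‖ₑ ^ q ∂ν := by
  have h := measure_ball_le_lintegral_gauss ν (c := α / 2 * q) (r := 1) (by positivity) a
  simp only [enorm_weighted_normKernel, gauss_rpow, gauss_sub_comm _ _ a]
  calc ν (Metric.ball a 1) = ENNReal.ofReal (Real.exp (α / 2 * q)) *
        (ENNReal.ofReal (Real.exp (-(α / 2 * q) * 1 ^ 2)) * ν (Metric.ball a 1)) := by
        rw [← mul_assoc, ← ENNReal.ofReal_mul (Real.exp_pos _).le, ← Real.exp_add]
        simp
    _ ≤ _ := by gcongr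

lemma exists_ballSup_le_embeddingNorm_rpow (n : ℕ) (α : ℝ) (hα : 0 < α) {q : ℝ} (hq : 0 < q) :
    ∃ C : ℝ≥0, 0 < C ∧ ∀ μ : Measure (Cn n), ballSup μ ≤ C * embeddingNorm α μ 1 q ^ q := by
  refine ⟨(Real.exp (α / 2 * q)).toNNReal, by simp [Real.exp_pos], fun μ => iSup_le fun a => ?_⟩
  refine (measure_ball_le_lintegral_normKernel μ hα hq a).trans ?_
  change _ ≤ ENNReal.ofReal _ * _
  gcongr
  rw [← eLpNorm_weighted_rpow hq]
  gcongr
  have := eLpNorm_weighted_le_embeddingNorm (μ := μ) hα le_rfl hq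
    (memFock_normKernel hα one_ne_zero a)
  rwa [fockNorm_normKernel hα one_ne_zero, mul_one] at this

/-- The Berezin transform at $a$ integrates a Gaussian that is at least $e^{-\alpha r^2}$ on the
ball. -/
lemma measure_ball_le_enorm_weighted_toeplitz (hα : 0 < α) (hμ : Admissible α μ) (a : Cn n)
    (r : ℝ) : μ (Metric.ball a r) ≤ ENNReal.ofReal (Real.exp (α * r ^ 2)) *
      ‖weighted α (toeplitz α μ (normKernel α a)) a‖ₑ := by
  calc μ (Metric.ball a r) = ENNReal.ofReal (Real.exp (α * r ^ 2)) *
        (ENNReal.ofReal (Real.exp (-α * r ^ 2)) * μ (Metric.ball a r)) := by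
        rw [← mul_assoc, ← ENNReal.ofReal_mul (Real.exp_pos _).le, ← Real.exp_add]
        simp
    _ ≤ _ := by
        rw [enorm_weighted_toeplitz_normKernel hμ]
        gcongr
        exact measure_ball_le_lintegral_gauss μ hα.le a

/-- The mass of a unit ball is controlled by the image of the kernel at its centre. -/
lemma exists_measure_ball_le_fockNorm_toeplitz (n : ℕ) (α : ℝ) (hα : 0 < α) {s : ℝ≥0∞}
    (hs : 1 ≤ s) :
    ∃ C : ℝ≥0, 0 < C ∧ ∀ μ : Measure (Cn n), Admissible α μ → ∀ a,
      μ (Metric.ball a 1) ≤ C * fockNorm α s (toeplitz α μ (normKernel α a)) := by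
  obtain ⟨D, hD, hpt⟩ := exists_enorm_weighted_le_fockNorm n α hα hs
  refine ⟨(Real.exp (α * 1 ^ 2)).toNNReal * D, mul_pos (by simp [Real.exp_pos]) hD,
    fun μ hμ a => (measure_ball_le_enorm_weighted_toeplitz hα hμ a 1).trans ?_⟩
  rw [ENNReal.coe_mul, mul_assoc]
  change _ ≤ ENNReal.ofReal _ * _
  gcongr
  exact hpt _ ((hμ.inToeplitzDomain_normKernel hα one_ne_zero a).differentiable hα) a

lemma exists_ballSup_le_toeplitzNorm (n : ℕ) (α : ℝ) (hα : 0 < α) {s : ℝ≥0∞} (hs : 1 ≤ s) :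
    ∃ C : ℝ≥0, 0 < C ∧ ∀ μ : Measure (Cn n), Admissible α μ →
      ballSup μ ≤ C * toeplitzNorm α μ 1 s := by
  obtain ⟨C, hC, h⟩ := exists_measure_ball_le_fockNorm_toeplitz n α hα hs
  refine ⟨C, hC, fun μ hμ => iSup_le fun a => (h μ hμ a).trans ?_⟩
  gcongr
  have := fockNorm_toeplitz_le_toeplitzNorm hα le_rfl (one_pos.trans_le hs).ne'
    (hμ.inToeplitzDomain_normKernel hα one_ne_zero a)
  rwa [fockNorm_normKernel hα one_ne_zero, mul_one] at this

end BallSup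

-- Separated families: overlap, sampling, synthesis and random signs

/-- The balls of radius `δ` about the points of the family are mutually disjoint. -/
def BallSeparated {n : ℕ} {ι : Type*} (δ : ℝ) (z : ι → Cn n) : Prop :=
  Pairwise fun j k => Disjoint (Metric.ball (z j) δ) (Metric.ball (z k) δ)

section Separated

variable {n : ℕ} {α δ : ℝ} {ι : Type*}

lemma BallSeparated.sum_setLIntegral_le {z : ι → Cn n} (hz : BallSeparated δ z) (s : Finset ι)
    (F : Cn n → ℝ≥0∞) :
    ∑ j ∈ s, ∫⁻ w in Metric.ball (z j) δ, F w ≤ ∫⁻ w, F w := by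
  rw [← lintegral_biUnion_finset (fun i _ j _ hij => hz hij)
    (fun j _ => Metric.isOpen_ball.measurableSet)]
  exact setLIntegral_le_lintegral _ _

/-- Each term is compared with a Gaussian integral over its own ball. For $w$ in that ball,
$|w-x|^2\le2|x-z_j|^2+2\delta^2$, so half the exponent is kept; disjointness bounds the sum by one
integral. -/
lemma exists_sum_gauss_le (n : ℕ) {c δ : ℝ} (hc : 0 < c) (hδ : 0 < δ) :
    ∃ N : ℝ≥0, ∀ {ι : Type*} (z : ι → Cn n), BallSeparated δ z → ∀ (s : Finset ι) (x : Cn n),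
      ∑ j ∈ s, gauss c (x - z j) ≤ N := by
  set V := volume (Metric.ball (0 : Cn n) δ) with hV
  have hV0 : V ≠ 0 := (Metric.measure_ball_pos volume 0 hδ).ne'
  have hVt : V ≠ ⊤ := measure_ball_lt_top.ne
  set e : ℝ≥0∞ := ENNReal.ofReal (Real.exp (-c * δ ^ 2)) with he
  have he0 : e ≠ 0 := by simp [he, Real.exp_pos]
  have het : e ≠ ⊤ := ENNReal.ofReal_ne_top
  set G : ℝ≥0∞ := ENNReal.ofReal ((Real.pi / (c / 2)) ^ n) with hG
  have hN : G / (e * V) ≠ ⊤ := ENNReal.div_ne_top ENNReal.ofReal_ne_top (mul_ne_zero he0 hV0)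
  refine ⟨(G / (e * V)).toNNReal, fun {ι} z hz s x => ?_⟩
  rw [ENNReal.coe_toNNReal hN, ENNReal.le_div_iff_mul_le (Or.inl (mul_ne_zero he0 hV0))
    (Or.inl (ENNReal.mul_ne_top het hVt)), Finset.sum_mul]
  calc ∑ j ∈ s, gauss c (x - z j) * (e * V)
      ≤ ∑ j ∈ s, ∫⁻ w in Metric.ball (z j) δ, gauss (c / 2) (w - x) := by
        gcongr with j
        rw [← mul_assoc, hV, ← Measure.addHaar_ball_center volume (z j), ← setLIntegral_const]
        refine setLIntegral_mono' Metric.isOpen_ball.measurableSet fun w hw => ?_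
        rw [he, gauss, gauss, ← ENNReal.ofReal_mul (Real.exp_pos _).le, ← Real.exp_add]
        gcongr ENNReal.ofReal (Real.exp ?_)
        have h1 : ‖w - x‖ ≤ ‖x - z j‖ + δ := by
          rw [Metric.mem_ball, dist_eq_norm] at hw
          have := norm_sub_le_norm_sub_add_norm_sub w (z j) x
          rw [norm_sub_rev (z j) x] at this
          linarith
        have h2 : ‖w - x‖ ^ 2 ≤ (‖x - z j‖ + δ) ^ 2 := by gcongr
        nlinarith [sq_nonneg (‖x - z j‖ - δ), mul_le_mul_of_nonneg_left h2 hc.le,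
          mul_nonneg hc.le (sq_nonneg (‖x - z j‖ - δ))]
    _ ≤ ∫⁻ w, gauss (c / 2) (w - x) := hz.sum_setLIntegral_le s _
    _ = G := lintegral_gauss_sub (by positivity) x

/-- Bounded overlap: an indicator of a ball of radius $r$ is at most $e^{r^2}$ times the Gaussian at
its centre. -/
lemma exists_sum_indicator_ball_le (n : ℕ) {δ : ℝ} (r : ℝ) (hδ : 0 < δ) :
    ∃ N : ℝ≥0, ∀ {ι : Type*} (z : ι → Cn n), BallSeparated δ z → ∀ (s : Finset ι) (x : Cn n),
      ∑ j ∈ s, (Metric.ball (z j) r).indicator 1 x ≤ (N : ℝ≥0∞) := by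
  obtain ⟨N, hN⟩ := exists_sum_gauss_le n one_pos hδ
  refine ⟨(Real.exp (r ^ 2)).toNNReal * N, fun {ι} z hz s x => ?_⟩
  rw [ENNReal.coe_mul]
  refine le_trans ?_ (mul_le_mul_right (hN z hz s x) _)
  rw [Finset.mul_sum]
  gcongr with j
  by_cases hx : x ∈ Metric.ball (z j) r
  swap
  · rw [Set.indicator_of_notMem hx]; exact zero_le
  rw [Set.indicator_of_mem hx]
  have h := le_gauss_of_norm_le (c := 1) (r := r) zero_le_one (x := x - z j)
    (by rw [← dist_eq_norm]; exact (Metric.mem_ball.1 hx).le)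
  calc (1 : ℝ≥0∞) = ENNReal.ofReal (Real.exp (r ^ 2)) *
        ENNReal.ofReal (Real.exp (-1 * r ^ 2)) := by
        rw [← ENNReal.ofReal_mul (Real.exp_pos _).le, ← Real.exp_add]; simp
    _ ≤ _ := mul_le_mul_right h _

/-- Sampling in `F^1` along a separated family. -/
lemma exists_sum_enorm_weighted_le (n : ℕ) (α : ℝ) (hα : 0 < α) {δ : ℝ} (hδ : 0 < δ) :
    ∃ C : ℝ≥0, 0 < C ∧ ∀ {ι : Type*} (z : ι → Cn n), BallSeparated δ z → ∀ (s : Finset ι)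
      (g : Cn n → ℂ), Differentiable ℂ g →
        ∑ j ∈ s, ‖weighted α g (z j)‖ₑ ≤ C * fockNorm α 1 g := by
  obtain ⟨C, hC, h⟩ := exists_enorm_weighted_le_lintegral_ball n α hα hδ
  have h1 := (fockConst_pos (n := n) hα one_ne_zero).ne'
  have ht := fockConst_ne_top (n := n) (α := α) (p := 1)
  have hi := ENNReal.inv_ne_top.2 h1
  refine ⟨C * (fockConst n α 1)⁻¹.toNNReal, mul_pos hC (ENNReal.toNNReal_pos
    (ENNReal.inv_ne_zero.2 ht) hi), fun {ι} z hz s g hg => ?_⟩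
  rw [fockNorm_eq one_ne_zero hg.continuous, eLpNorm_one_eq_lintegral_enorm, ENNReal.coe_mul,
    ENNReal.coe_toNNReal hi, mul_assoc, ← mul_assoc _ (fockConst n α 1),
    ENNReal.inv_mul_cancel h1 ht, one_mul]
  calc ∑ j ∈ s, ‖weighted α g (z j)‖ₑ
      ≤ ∑ j ∈ s, C * ∫⁻ w in Metric.ball (z j) δ, ‖weighted α g w‖ₑ := by
        gcongr with j; exact h g hg (z j)
    _ ≤ C * ∫⁻ w, ‖weighted α g w‖ₑ := by
        rw [← Finset.mul_sum]
        gcongr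
        exact hz.sum_setLIntegral_le s _

lemma enorm_weighted_sum_normKernel_le (s : Finset ι) (z : ι → Cn n) (c : ι → ℂ) (x : Cn n) :
    ‖weighted α (fun w => ∑ j ∈ s, c j * normKernel α (z j) w) x‖ₑ ≤
      ∑ j ∈ s, gauss (α / 2) (x - z j) * ‖c j‖ₑ := by
  have : weighted α (fun w => ∑ j ∈ s, c j * normKernel α (z j) w) x =
      ∑ j ∈ s, c j * weighted α (normKernel α (z j)) x := by
    simp only [weighted, Finset.sum_mul, mul_assoc]
  rw [this]
  refine (enorm_sum_le _ _).trans (le_of_eq ?_)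
  refine Finset.sum_congr rfl fun j _ => ?_
  rw [enorm_mul, enorm_weighted_normKernel, mul_comm]

lemma differentiable_sum_normKernel (s : Finset ι) (z : ι → Cn n) (c : ι → ℂ) :
    Differentiable ℂ fun w => ∑ j ∈ s, c j * normKernel α (z j) w :=
  Differentiable.fun_sum fun j _ => (differentiable_normKernel (z j)).const_mul _

/-- Synthesis of `F^p` functions from `ℓ^p` coefficients. -/
lemma exists_fockNorm_sum_normKernel_le (n : ℕ) (α : ℝ) (hα : 0 < α) {δ : ℝ} (hδ : 0 < δ)
    {p : ℝ≥0∞} (hp : 1 ≤ p) (hpt : p ≠ ⊤) :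
    ∃ C : ℝ≥0, ∀ {ι : Type*} (z : ι → Cn n), BallSeparated δ z → ∀ (s : Finset ι) (c : ι → ℂ),
      fockNorm α p (fun w => ∑ j ∈ s, c j * normKernel α (z j) w) ≤
        C * (∑ j ∈ s, ‖c j‖ₑ ^ p.toReal) ^ (1 / p.toReal) := by
  obtain ⟨N, hN⟩ := exists_sum_gauss_le n (c := α / 2) (by positivity) hδ
  have hp0 : p ≠ 0 := (one_pos.trans_le hp).ne'
  have hp1 : 1 ≤ p.toReal := by simpa using ENNReal.toReal_mono hpt hp
  have hpp : 0 < p.toReal := by linarith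
  set G : ℝ≥0∞ := ENNReal.ofReal ((Real.pi / (α / 2)) ^ n) with hG
  set D : ℝ≥0∞ := fockConst n α p * ((N : ℝ≥0∞) ^ (p.toReal - 1) * G) ^ (1 / p.toReal) with hD
  have hDt : D ≠ ⊤ := by
    refine ENNReal.mul_ne_top fockConst_ne_top (ENNReal.rpow_ne_top_of_nonneg (by positivity) ?_)
    exact ENNReal.mul_ne_top (ENNReal.rpow_ne_top_of_nonneg (by linarith) ENNReal.coe_ne_top)
      ENNReal.ofReal_ne_top
  refine ⟨D.toNNReal, fun {ι} z hz s c => ?_⟩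
  rw [ENNReal.coe_toNNReal hDt, fockNorm_eq hp0 (differentiable_sum_normKernel s z c).continuous,
    hD, mul_assoc, ← ENNReal.mul_rpow_of_nonneg _ _ (by positivity),
    eLpNorm_eq_lintegral_rpow_enorm_toReal hp0 hpt]
  gcongr
  calc ∫⁻ x, ‖weighted α (fun w => ∑ j ∈ s, c j * normKernel α (z j) w) x‖ₑ ^ p.toReal
      ≤ ∫⁻ x, (N : ℝ≥0∞) ^ (p.toReal - 1) *
          ∑ j ∈ s, gauss (α / 2) (x - z j) * ‖c j‖ₑ ^ p.toReal := by
        refine lintegral_mono fun x => ?_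
        -- Weighted power mean inequality with the Gaussians as weights; their sum is at most $N$,
        -- leaving the factor $N^{p-1}$.
        have h1 := (enorm_weighted_sum_normKernel_le (α := α) s z c x).trans
          (ENNReal.inner_le_weight_mul_Lp_of_nonneg s hp1 (fun j => gauss (α / 2) (x - z j))
            fun j => ‖c j‖ₑ)
        refine (ENNReal.rpow_le_rpow h1 hpp.le).trans ?_
        rw [ENNReal.mul_rpow_of_nonneg _ _ hpp.le, ENNReal.rpow_inv_rpow hpp.ne',
          ← ENNReal.rpow_mul, sub_mul, one_mul, inv_mul_cancel₀ hpp.ne']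
        gcongr
        exact hN z hz s x
    _ = (N : ℝ≥0∞) ^ (p.toReal - 1) * ∑ j ∈ s, G * ‖c j‖ₑ ^ p.toReal := by
        rw [lintegral_const_mul _ (by fun_prop), lintegral_finsetSum _ (by fun_prop)]
        congr 1
        refine Finset.sum_congr rfl fun j _ => ?_
        rw [lintegral_mul_const _ (by fun_prop), lintegral_gauss_sub (by positivity)]
    _ = _ := by rw [← Finset.mul_sum, mul_assoc]

lemma exists_fockNorm_top_sum_normKernel_le (n : ℕ) (α : ℝ) (hα : 0 < α) {δ : ℝ} (hδ : 0 < δ) :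
    ∃ C : ℝ≥0, ∀ {ι : Type*} (z : ι → Cn n), BallSeparated δ z → ∀ (s : Finset ι) (c : ι → ℂ),
      (∀ j, ‖c j‖ₑ ≤ 1) → fockNorm α ⊤ (fun w => ∑ j ∈ s, c j * normKernel α (z j) w) ≤ C := by
  obtain ⟨N, hN⟩ := exists_sum_gauss_le n (c := α / 2) (by positivity) hδ
  refine ⟨N, fun {ι} z hz s c hc => ?_⟩
  have hcont := (differentiable_sum_normKernel (α := α) s z c).continuous
  rw [fockNorm_eq ENNReal.top_ne_zero hcont, eLpNorm_top_eq_iSup (continuous_weighted hcont),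
    fockConst, if_pos rfl, one_mul]
  refine iSup_le fun x => (enorm_weighted_sum_normKernel_le s z c x).trans ?_
  refine le_trans ?_ (hN z hz s x)
  gcongr with j
  exact mul_le_of_le_one_right' (hc j)

/-- Random signs do not decrease any single term on average. -/
lemma card_mul_enorm_le_sum_signs {κ : Type*} [Fintype κ] [DecidableEq κ] (a : κ → ℂ) (j₀ : κ) :
    (Fintype.card (κ → Bool) : ℝ≥0∞) * ‖a j₀‖ₑ ≤
      ∑ ε : κ → Bool, ‖∑ j, (if ε j then (1 : ℂ) else -1) * a j‖ₑ := by
  set X : (κ → Bool) → ℂ := fun ε => ∑ j, (if ε j then (1 : ℂ) else -1) * a j with hX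
  -- Sign vectors are paired by flipping the sign at $j_0$; the two sums differ by $\pm2a_{j_0}$, so
  -- one triangle inequality suffices.
  set flip : (κ → Bool) → (κ → Bool) := fun ε => Function.update ε j₀ (!ε j₀) with hflip
  have hinv : Function.Involutive flip := fun ε => by
    ext j; by_cases h : j = j₀
    · subst h; simp [hflip]
    · simp [hflip, h]
  have hsum : ∑ ε, ‖X (flip ε)‖ₑ = ∑ ε, ‖X ε‖ₑ :=
    Equiv.sum_comp hinv.toPerm fun ε => ‖X ε‖ₑ
  have hdiff : ∀ ε, X ε - X (flip ε) = 2 * ((if ε j₀ then (1 : ℂ) else -1) * a j₀) := fun ε => by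
    rw [hX]
    simp only
    rw [← Finset.sum_sub_distrib, Finset.sum_eq_single j₀]
    · simp only [hflip, Function.update_self]
      cases ε j₀ <;> simp <;> ring
    · intro j _ hj; simp [hflip, hj]
    · simp
  have hle : ∀ ε, 2 * ‖a j₀‖ₑ ≤ ‖X ε‖ₑ + ‖X (flip ε)‖ₑ := fun ε => by
    refine le_trans (le_of_eq ?_) enorm_sub_le
    rw [hdiff, enorm_mul, enorm_mul]
    have : ‖(if ε j₀ then (1 : ℂ) else -1)‖ₑ = 1 := by split_ifs <;> simp
    rw [this, one_mul, ← ofReal_norm (2 : ℂ)]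
    simp
  have h2 : (2 : ℝ≥0∞) * ((Fintype.card (κ → Bool) : ℝ≥0∞) * ‖a j₀‖ₑ) ≤ 2 * ∑ ε, ‖X ε‖ₑ := by
    calc (2 : ℝ≥0∞) * ((Fintype.card (κ → Bool) : ℝ≥0∞) * ‖a j₀‖ₑ)
        = ∑ _ε : κ → Bool, 2 * ‖a j₀‖ₑ := by
          rw [Finset.sum_const, Finset.card_univ, nsmul_eq_mul]; ring
      _ ≤ ∑ ε, (‖X ε‖ₑ + ‖X (flip ε)‖ₑ) := Finset.sum_le_sum fun ε _ => hle ε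
      _ = _ := by rw [Finset.sum_add_distrib, hsum, two_mul]
  exact (ENNReal.mul_le_mul_iff_right (by simp) (by simp)).1 h2

end Separated

-- Source space $\mathcal F^p$, $p>1$: masses in the dual sequence space

section Lattice

variable {n : ℕ} {α : ℝ} {p : ℝ≥0∞} {μ : Measure (Cn n)}

/-- The weighted modulus of $T_\mu(\sum_i\pm l_ik_{z_i})$ at $z_j$, averaged over signs, is at least
that of the diagonal term $l_jT_\mu k_{z_j}$, hence at least a multiple of $l_j\mu(D(z_j,r))$.
Sampling in $\mathcal F^1$ bounds the sum over $j$ for each choice of signs. The bound $B$ is asked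
of all coefficients of moduli $l_j$, so it survives the signs. -/
lemma exists_sum_mul_measure_ball_le (n : ℕ) (α : ℝ) (hα : 0 < α) {δ : ℝ} (hδ : 0 < δ) (r : ℝ)
    {p : ℝ≥0∞} (hp : 1 ≤ p) :
    ∃ C : ℝ≥0, ∀ μ : Measure (Cn n), Admissible α μ → ∀ {ι : Type*} (z : ι → Cn n),
      BallSeparated δ z → ∀ (s : Finset ι) (l : ι → ℝ≥0) (B : ℝ≥0∞),
      (∀ c : s → ℂ, (∀ j, ‖c j‖ₑ = l j) →
        fockNorm α p (fun w => ∑ j, c j * normKernel α (z j) w) ≤ B) →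
      ∑ j ∈ s, l j * μ (Metric.ball (z j) r) ≤ C * toeplitzNorm α μ p 1 * B := by
  have hp0 : p ≠ 0 := (one_pos.trans_le hp).ne'
  obtain ⟨D, hD, hsamp⟩ := exists_sum_enorm_weighted_le n α hα hδ
  refine ⟨(Real.exp (α * r ^ 2)).toNNReal * D, fun μ hμ {ι} z hz s l B hB => ?_⟩
  classical
  set e : ℝ≥0∞ := ((Real.exp (α * r ^ 2)).toNNReal : ℝ≥0∞) with he
  set M : ℝ≥0∞ := (Fintype.card (s → Bool) : ℝ≥0∞) with hM
  have hM0 : M ≠ 0 := by rw [hM]; exact_mod_cast Fintype.card_ne_zero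
  have hMt : M ≠ ⊤ := ENNReal.natCast_ne_top _
  set c : (s → Bool) → s → ℂ := fun ε j => (if ε j then (1 : ℂ) else -1) * ((l j : ℝ) : ℂ) with hc
  have hcn : ∀ ε j, ‖c ε j‖ₑ = l j := fun ε j => by
    have : ‖(if ε j then (1 : ℂ) else -1)‖ₑ = 1 := by split_ifs <;> simp
    rw [hc]; simp only
    rw [enorm_mul, this, one_mul, ← ofReal_norm, Complex.norm_real,
      Real.norm_of_nonneg (l j).coe_nonneg, ENNReal.ofReal_coe_nnreal]
  have hdom : ∀ j, InToeplitzDomain α μ p (normKernel α (z j)) := fun j =>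
    hμ.inToeplitzDomain_normKernel hα hp0 (z j)
  have hdomc : ∀ ε (j : s), InToeplitzDomain α μ p (fun w => c ε j * normKernel α (z j) w) :=
    fun ε j => (hdom j).const_mul hp0 _
  set f : (s → Bool) → Cn n → ℂ := fun ε w => ∑ j, c ε j * normKernel α (z j) w with hf
  have hfdom : ∀ ε, InToeplitzDomain α μ p (f ε) := fun ε =>
    InToeplitzDomain.sum hα hp0 Finset.univ fun j _ => hdomc ε j
  have hTf : ∀ ε x, weighted α (toeplitz α μ (f ε)) x = ∑ j, (if ε j then (1 : ℂ) else -1) *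
      (((l j : ℝ) : ℂ) * weighted α (toeplitz α μ (normKernel α (z j))) x) := fun ε x => by
    rw [hf]; simp only
    rw [weighted, toeplitz_sum Finset.univ fun j _ => hdomc ε j]
    simp only [toeplitz_const_mul, Finset.sum_mul, weighted, hc, mul_assoc]
  have hzs : BallSeparated δ fun j : s => z j := fun j k hjk =>
    hz fun h => hjk (Subtype.ext h)
  have hstep : ∀ j : s, M * (l j * μ (Metric.ball (z j) r)) ≤
      e * ∑ ε, ‖weighted α (toeplitz α μ (f ε)) (z j)‖ₑ := fun j => by
    have h1 := measure_ball_le_enorm_weighted_toeplitz hα hμ (z j) r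
    have h2 := card_mul_enorm_le_sum_signs (fun i : s => ((l i : ℝ) : ℂ) *
      weighted α (toeplitz α μ (normKernel α (z i))) (z j)) j
    simp only [← hTf] at h2
    rw [enorm_mul, ← ofReal_norm (((l j : ℝ≥0) : ℝ) : ℂ), Complex.norm_real,
      Real.norm_of_nonneg (l j).coe_nonneg, ENNReal.ofReal_coe_nnreal] at h2
    calc M * (l j * μ (Metric.ball (z j) r))
        ≤ M * (l j * (e * ‖weighted α (toeplitz α μ (normKernel α (z j))) (z j)‖ₑ)) := by
          gcongr; exact h1
      _ = e * (M * (l j * ‖weighted α (toeplitz α μ (normKernel α (z j))) (z j)‖ₑ)) := by ring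
      _ ≤ _ := by gcongr
  have hfin : M * ∑ j ∈ s, l j * μ (Metric.ball (z j) r) ≤
      M * (e * D * toeplitzNorm α μ p 1 * B) := by
    rw [← Finset.sum_coe_sort s, Finset.mul_sum]
    calc ∑ j : s, M * (l j * μ (Metric.ball (z j) r))
        ≤ ∑ j : s, e * ∑ ε, ‖weighted α (toeplitz α μ (f ε)) (z j)‖ₑ :=
          Finset.sum_le_sum fun j _ => hstep j
      _ = e * ∑ ε, ∑ j : s, ‖weighted α (toeplitz α μ (f ε)) (z j)‖ₑ := by
          rw [← Finset.mul_sum, Finset.sum_comm]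
      _ ≤ e * ∑ _ε : s → Bool, D * (toeplitzNorm α μ p 1 * B) := by
          gcongr with ε
          refine (hsamp _ hzs Finset.univ _ ((hfdom ε).differentiable hα)).trans ?_
          gcongr
          refine (fockNorm_toeplitz_le_toeplitzNorm hα hp one_ne_zero (hfdom ε)).trans ?_
          gcongr
          exact hB _ (hcn ε)
      _ = M * (e * D * toeplitzNorm α μ p 1 * B) := by
          rw [Finset.sum_const, Finset.card_univ, nsmul_eq_mul]; ring
  rw [ENNReal.coe_mul]
  exact (ENNReal.mul_le_mul_iff_right hM0 hMt).1 hfin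

lemma conjExponent_top_toReal : (ENNReal.conjExponent ⊤).toReal = 1 := by
  simp [ENNReal.conjExponent]

lemma holderConjugate_toReal (hp : 1 < p) (hpt : p ≠ ⊤) :
    p.toReal.HolderConjugate (ENNReal.conjExponent p).toReal := by
  have h1 : 1 < p.toReal := by
    simpa using (ENNReal.toReal_lt_toReal ENNReal.one_ne_top hpt).2 hp
  have : (ENNReal.conjExponent p).toReal = Real.conjExponent p.toReal := by
    have h := ENNReal.toReal_sub_of_le hp.le hpt
    have hne : p - 1 ≠ 0 := (tsub_pos_of_lt hp).ne'
    rw [ENNReal.conjExponent, ENNReal.toReal_add ENNReal.one_ne_top (ENNReal.inv_ne_top.2 hne),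
      ENNReal.toReal_inv, h, Real.conjExponent]
    simp only [ENNReal.toReal_one]
    have : p.toReal - 1 ≠ 0 := by linarith
    field_simp
    ring
  rw [this]
  exact Real.HolderConjugate.conjExponent h1

lemma conjExponent_toReal_ge_one (hp : 1 < p) : 1 ≤ (ENNReal.conjExponent p).toReal := by
  rcases eq_or_ne p ⊤ with rfl | hpt
  · rw [conjExponent_top_toReal]
  · exact (holderConjugate_toReal hp hpt).symm.lt.le

/-- Boundedness of `T_μ : F^p → F^1` forces the masses of the balls of a separated family to be
in the dual sequence space. -/
lemma exists_tsum_measure_ball_le (n : ℕ) (α : ℝ) (hα : 0 < α) {δ : ℝ} (hδ : 0 < δ) (r : ℝ)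
    {p : ℝ≥0∞} (hp : 1 < p) :
    ∃ C : ℝ≥0, ∀ μ : Measure (Cn n), Admissible α μ → ∀ {ι : Type*} (z : ι → Cn n),
      BallSeparated δ z →
      ∑' j, μ (Metric.ball (z j) r) ^ (ENNReal.conjExponent p).toReal ≤
        (C * toeplitzNorm α μ p 1) ^ (ENNReal.conjExponent p).toReal := by
  obtain ⟨C, hC⟩ := exists_sum_mul_measure_ball_le n α hα hδ r hp.le
  rcases eq_or_ne p ⊤ with rfl | hpt
  -- For $p=\infty$ unimodular coefficients already give the $\ell^1$ bound.
  · obtain ⟨D, hD⟩ := exists_fockNorm_top_sum_normKernel_le n α hα hδ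
    refine ⟨C * D, fun μ hμ {ι} z hz => ?_⟩
    simp only [conjExponent_top_toReal, ENNReal.rpow_one]
    refine ENNReal.summable.tsum_le_of_sum_le fun s => ?_
    have := hC μ hμ z hz s (fun _ => 1) D fun c hc => hD (fun j : s => z j)
      (fun j k hjk => hz fun h => hjk (Subtype.ext h)) Finset.univ c fun j => (hc j).le
    simp only [ENNReal.coe_one, one_mul] at this
    refine this.trans (le_of_eq ?_)
    push_cast; ring
  · obtain ⟨D, hD⟩ := exists_fockNorm_sum_normKernel_le n α hα hδ hp.le hpt
    have hpq := holderConjugate_toReal hp hpt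
    set q := (ENNReal.conjExponent p).toReal with hq
    set P := p.toReal with hP
    refine ⟨C * D, fun μ hμ {ι} z hz => ENNReal.summable.tsum_le_of_sum_le fun s => ?_⟩
    set m : ι → ℝ≥0∞ := fun j => μ (Metric.ball (z j) r) with hm
    have hmt : ∀ j, m j ≠ ⊤ := fun j => (hμ.measure_ball_lt_top hα _ _).ne
    set X : ℝ≥0∞ := ∑ j ∈ s, m j ^ q with hX
    have hXt : X ≠ ⊤ := ENNReal.sum_ne_top.2 fun j _ =>
      ENNReal.rpow_ne_top_of_nonneg hpq.symm.nonneg (hmt j)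
    -- The extremal choice in Hölder: with $l_j=m_j^{q-1}$ both $l_jm_j$ and $l_j^P$ equal $m_j^q$.
    set l : ι → ℝ≥0 := fun j => (m j ^ (q - 1)).toNNReal with hl
    have hq1 : 0 < q - 1 := sub_pos.2 hpq.symm.lt
    have hlm : ∀ j, (l j : ℝ≥0∞) = m j ^ (q - 1) := fun j =>
      ENNReal.coe_toNNReal (ENNReal.rpow_ne_top_of_nonneg hq1.le (hmt j))
    have hlp : ∀ j, (l j : ℝ≥0∞) ^ P = m j ^ q := fun j => by
      rw [hlm, ← ENNReal.rpow_mul]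
      congr 1
      exact hpq.symm.sub_one_mul_conj
    have hmain := hC μ hμ z hz s l (D * X ^ (1 / P)) fun c hc => by
      refine (hD (fun j : s => z j) (fun j k hjk => hz fun h => hjk (Subtype.ext h))
        Finset.univ c).trans (le_of_eq ?_)
      simp only [hc, hlp]
      rw [hX, ← Finset.sum_coe_sort s fun j => m j ^ q]
    have hlhs : ∑ j ∈ s, l j * μ (Metric.ball (z j) r) = X := by
      refine Finset.sum_congr rfl fun j _ => ?_
      change (l j : ℝ≥0∞) * m j = m j ^ q
      rw [hlm]
      nth_rw 2 [← ENNReal.rpow_one (m j)]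
      rw [← ENNReal.rpow_add_of_nonneg _ _ hq1.le zero_le_one, sub_add_cancel]
    rw [hlhs] at hmain
    rcases eq_or_ne X 0 with h0 | h0
    · rw [h0]; exact zero_le
    rw [← ENNReal.rpow_inv_le_iff hpq.symm.pos]
    -- The estimate reads $X\le CD\|T_\mu\|X^{1/P}$. Dividing is legitimate because $X$ is a finite
    -- sum of finite terms and is nonzero here.
    have hsplit : X = X ^ q⁻¹ * X ^ (1 / P) := by
      rw [← ENNReal.rpow_add _ _ h0 hXt, one_div, add_comm, hpq.inv_add_inv_eq_one,
        ENNReal.rpow_one]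
    have hXP0 : X ^ (1 / P) ≠ 0 := (ENNReal.rpow_pos (pos_iff_ne_zero.2 h0) hXt).ne'
    have hXPt : X ^ (1 / P) ≠ ⊤ :=
      ENNReal.rpow_ne_top_of_nonneg (one_div_nonneg.2 hpq.nonneg) hXt
    refine (ENNReal.mul_le_mul_iff_left hXP0 hXPt).1 ?_
    rw [← hsplit]
    refine hmain.trans (le_of_eq ?_)
    push_cast; ring

/-- The Carleson estimate from the dual sequence space condition. -/
lemma exists_lintegral_weighted_le_tsum (n : ℕ) (α : ℝ) (hα : 0 < α) {δ : ℝ} (hδ : 0 < δ) (r : ℝ)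
    {p : ℝ≥0∞} (hp : 1 < p) :
    ∃ C : ℝ≥0, 0 < C ∧ ∀ μ : Measure (Cn n), ∀ {ι : Type*} [Countable ι] (z : ι → Cn n),
      BallSeparated δ z → (⋃ j, Metric.ball (z j) r) = Set.univ →
      ∀ f : Cn n → ℂ, Differentiable ℂ f → ∫⁻ w, ‖weighted α f w‖ₑ ∂μ ≤
        C * (∑' j, μ (Metric.ball (z j) r) ^ (ENNReal.conjExponent p).toReal) ^
          (1 / (ENNReal.conjExponent p).toReal) * fockNorm α p f := by
  have hp0 : p ≠ 0 := (one_pos.trans hp).ne'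
  obtain ⟨C, hC, hpt⟩ := exists_enorm_weighted_le_eLpNorm_ball n α hα one_pos hp.le
  have h1 := (fockConst_pos (n := n) hα hp0).ne'
  have ht := fockConst_ne_top (n := n) (α := α) (p := p)
  have hi := ENNReal.inv_ne_top.2 h1
  have hi0 := ENNReal.inv_ne_zero.2 ht
  obtain ⟨N, hN⟩ := exists_sum_indicator_ball_le n (r + 1) hδ
  have hpow : 0 < ((N + 1 : ℝ≥0) : ℝ≥0) ^ (1 / p.toReal) := NNReal.rpow_pos (by positivity)
  -- Using $N+1$ for the overlap bound $N$ keeps the constant positive.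
  refine ⟨C * ((N + 1) ^ (1 / p.toReal) * (fockConst n α p)⁻¹.toNNReal),
    mul_pos hC (mul_pos hpow (ENNReal.toNNReal_pos hi0 hi)), fun μ {ι} _ z hz hcov f hf => ?_⟩
  have hWc := continuous_weighted (α := α) hf.continuous
  set q := (ENNReal.conjExponent p).toReal with hq
  set m : ι → ℝ≥0∞ := fun j => μ (Metric.ball (z j) r) with hm
  set t : ι → ℝ≥0∞ := fun j =>
    eLpNorm (weighted α f) p (volume.restrict (Metric.ball (z j) (r + 1))) with hts
  set W := eLpNorm (weighted α f) p volume with hW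
  -- For $w\in D(z_j,r)$ the unit ball about $w$ lies in $D(z_j,r+1)$, so the weighted modulus on
  -- the whole ball is controlled by one local norm $t_j$.
  have hlocal : ∫⁻ w, ‖weighted α f w‖ₑ ∂μ ≤ ∑' j, C * (t j * m j) := by
    rw [← setLIntegral_univ, ← hcov]
    refine (lintegral_iUnion_le _ _).trans (ENNReal.tsum_le_tsum fun j => ?_)
    rw [← mul_assoc, ← setLIntegral_const]
    refine setLIntegral_mono' Metric.isOpen_ball.measurableSet fun w hw => ?_
    refine (hpt f hf w).trans ?_
    gcongr
    refine eLpNorm_mono_measure _ (Measure.restrict_mono (Metric.ball_subset_ball' ?_) le_rfl)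
    rw [Metric.mem_ball] at hw
    linarith
  have hholder : ∑' j, t j * m j ≤
      (((N + 1 : ℝ≥0) ^ (1 / p.toReal) : ℝ≥0) : ℝ≥0∞) * W * (∑' j, m j ^ q) ^ (1 / q) := by
    rcases eq_or_ne p ⊤ with rfl | hpT
    · rw [hq, conjExponent_top_toReal]
      simp only [ENNReal.rpow_one, ENNReal.toReal_top, div_zero, NNReal.rpow_zero,
        ENNReal.coe_one, one_mul, one_div, inv_one]
      rw [← ENNReal.tsum_mul_left]
      refine ENNReal.tsum_le_tsum fun j => ?_
      gcongr
      exact eLpNorm_mono_measure _ Measure.restrict_le_self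
    · have hpq := holderConjugate_toReal hp hpT
      refine ENNReal.summable.tsum_le_of_sum_le fun s => ?_
      refine (ENNReal.inner_le_Lp_mul_Lq s t m hpq).trans ?_
      have hsum : ∑ j ∈ s, t j ^ p.toReal ≤ (N + 1 : ℝ≥0) * W ^ p.toReal := by
        have hpow : ∀ ν : Measure (Cn n), eLpNorm (weighted α f) p ν ^ p.toReal =
            ∫⁻ x, ‖weighted α f x‖ₑ ^ p.toReal ∂ν := fun ν => by
          rw [eLpNorm_eq_lintegral_rpow_enorm_toReal hp0 hpT, one_div,
            ENNReal.rpow_inv_rpow hpq.pos.ne']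
        have hmeas : Measurable fun x => ‖weighted α f x‖ₑ ^ p.toReal :=
          hWc.enorm.measurable.pow_const _
        simp only [hts, hW, hpow]
        calc ∑ j ∈ s, ∫⁻ x in Metric.ball (z j) (r + 1), ‖weighted α f x‖ₑ ^ p.toReal
            = ∫⁻ x, ∑ j ∈ s, (Metric.ball (z j) (r + 1)).indicator 1 x *
                ‖weighted α f x‖ₑ ^ p.toReal := by
              have hmj : ∀ j ∈ s, Measurable fun x =>
                  (Metric.ball (z j) (r + 1)).indicator 1 x * ‖weighted α f x‖ₑ ^ p.toReal :=
                fun j _ => (measurable_one.indicator Metric.isOpen_ball.measurableSet).mul hmeas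
              rw [lintegral_finsetSum _ hmj]
              refine Finset.sum_congr rfl fun j _ => ?_
              rw [← lintegral_indicator Metric.isOpen_ball.measurableSet]
              refine lintegral_congr fun x => ?_
              by_cases hx : x ∈ Metric.ball (z j) (r + 1)
              · rw [Set.indicator_of_mem hx, Set.indicator_of_mem hx, Pi.one_apply, one_mul]
              · rw [Set.indicator_of_notMem hx, Set.indicator_of_notMem hx, zero_mul]
          _ ≤ ∫⁻ x, (N + 1 : ℝ≥0) * ‖weighted α f x‖ₑ ^ p.toReal := by
              refine lintegral_mono fun x => ?_
              rw [← Finset.sum_mul]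
              gcongr
              refine (hN z hz s x).trans ?_
              exact_mod_cast le_self_add
          _ = _ := lintegral_const_mul' _ _ ENNReal.coe_ne_top
      gcongr
      · refine (ENNReal.rpow_le_rpow hsum (one_div_nonneg.2 hpq.nonneg)).trans (le_of_eq ?_)
        rw [ENNReal.mul_rpow_of_nonneg _ _ (one_div_nonneg.2 hpq.nonneg), one_div,
          ENNReal.rpow_rpow_inv hpq.pos.ne', ENNReal.coe_rpow_of_nonneg _
          (inv_nonneg.2 hpq.nonneg)]
      · exact ENNReal.sum_le_tsum s
  rw [fockNorm_eq hp0 hf.continuous, ENNReal.coe_mul, ENNReal.coe_mul, ENNReal.coe_toNNReal hi]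
  refine hlocal.trans ?_
  rw [ENNReal.tsum_mul_left]
  refine (mul_le_mul_right hholder _).trans (le_of_eq ?_)
  set K := (((N + 1 : ℝ≥0) ^ (1 / p.toReal) : ℝ≥0) : ℝ≥0∞)
  calc _ = C * (K * W * (∑' j, m j ^ q) ^ (1 / q)) * ((fockConst n α p)⁻¹ * fockConst n α p) := by
        rw [ENNReal.inv_mul_cancel h1 ht, mul_one]
    _ = _ := by ring

/-- A separated family of points whose balls cover `ℂⁿ`. -/
lemma exists_ballSeparated_cover (n : ℕ) :
    ∃ z : (Fin n → ℤ × ℤ) → Cn n, BallSeparated (1 / 2) z ∧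
      (⋃ k, Metric.ball (z k) (n + 1)) = Set.univ := by
  -- The Gaussian integer lattice: distinct points are at distance at least 1. Rounding moves each
  -- coordinate by modulus at most 1, and $n<(n+1)^2$ gives the cover.
  refine ⟨fun k => WithLp.toLp 2 fun i => ⟨(k i).1, (k i).2⟩, fun j k hjk => ?_, ?_⟩
  · refine Metric.ball_disjoint_ball ?_
    obtain ⟨i, hi⟩ := Function.ne_iff.1 hjk
    rw [dist_eq_norm]
    refine le_trans ?_ (PiLp.norm_apply_le _ i)
    have hint : ∀ a b : ℤ, a ≠ b → (1 : ℝ) ≤ |(a : ℝ) - b| := fun a b hab => by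
      have := Int.one_le_abs (sub_ne_zero.2 hab)
      exact_mod_cast this
    norm_num
    by_cases h1 : (j i).1 = (k i).1
    · have h2 : (j i).2 ≠ (k i).2 := fun h2 => hi (Prod.ext h1 h2)
      refine (hint _ _ h2).trans ?_
      simpa using Complex.abs_im_le_norm ((⟨(j i).1, (j i).2⟩ : ℂ) - ⟨(k i).1, (k i).2⟩)
    · refine (hint _ _ h1).trans ?_
      simpa using Complex.abs_re_le_norm ((⟨(j i).1, (j i).2⟩ : ℂ) - ⟨(k i).1, (k i).2⟩)
  · refine Set.eq_univ_of_forall fun w => Set.mem_iUnion.2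
      ⟨fun i => (round (w i).re, round (w i).im), ?_⟩
    rw [Metric.mem_ball, dist_eq_norm, EuclideanSpace.norm_eq, Real.sqrt_lt' (by positivity)]
    calc _ ≤ ∑ _i : Fin n, (1 : ℝ) := by
          refine Finset.sum_le_sum fun i _ => ?_
          have h1 := abs_sub_round (w i).re
          have h2 := abs_sub_round (w i).im
          have h := Complex.norm_le_abs_re_add_abs_im
            (w i - (⟨round (w i).re, round (w i).im⟩ : ℂ))
          simp only [Complex.sub_re, Complex.sub_im] at h
          rw [PiLp.sub_apply]
          exact pow_le_one₀ (norm_nonneg _) (by linarith)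
      _ < _ := by simp; nlinarith

end Lattice

-- Compactness: tightness, and kernels escaping to infinity

/-- The Carleson embedding of `F^p` into `L¹` is small outside large balls. -/
def CarlesonTight {n : ℕ} (α : ℝ) (μ : Measure (Cn n)) (p : ℝ≥0∞) : Prop :=
  ∀ ε : ℝ≥0, 0 < ε → ∃ R : ℝ, ∀ f : Cn n → ℂ, MemFock α p f →
    ∫⁻ w in (Metric.ball 0 R)ᶜ, ‖weighted α f w‖ₑ ∂μ ≤ ε * fockNorm α p f

/-- The masses of the unit balls tend to zero at infinity. -/
def BallVanishing {n : ℕ} (μ : Measure (Cn n)) : Prop :=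
  ∀ ε : ℝ≥0, 0 < ε → ∃ R : ℝ, ∀ a, R ≤ ‖a‖ → μ (Metric.ball a 1) ≤ ε

section Compactness

variable {n : ℕ} {α : ℝ} {p : ℝ≥0∞} {μ : Measure (Cn n)}

/-- Fatou's lemma for the weighted functions. -/
lemma fockNorm_le_one_of_tendsto (hα : 0 < α) (hp : 1 ≤ p) {F : ℕ → Cn n → ℂ} {g : Cn n → ℂ}
    (hF : ∀ m, Continuous (F m)) (hF1 : ∀ m, fockNorm α p (F m) ≤ 1) (hg : Continuous g)
    (hlim : ∀ z, Tendsto (fun m => F m z) atTop (𝓝 (g z))) : fockNorm α p g ≤ 1 := by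
  have hp0 : p ≠ 0 := (one_pos.trans_le hp).ne'
  have h0 := (fockConst_pos (n := n) hα hp0).ne'
  have ht := fockConst_ne_top (n := n) (α := α) (p := p)
  have hle : ∀ m, eLpNorm (weighted α (F m)) p volume ≤ (fockConst n α p)⁻¹ := fun m => by
    have := hF1 m
    rw [fockNorm_eq hp0 (hF m)] at this
    rwa [← one_div, ENNReal.le_div_iff_mul_le (Or.inl h0) (Or.inl ht), mul_comm]
  have hlimW : ∀ z, Tendsto (fun m => weighted α (F m) z) atTop (𝓝 (weighted α g z)) :=
    fun z => (hlim z).mul_const _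
  have := Lp.eLpNorm_lim_le_liminf_eLpNorm (p := p) (μ := volume)
    (fun m => (continuous_weighted (α := α) (hF m)).aestronglyMeasurable) (weighted α g)
    (Eventually.of_forall hlimW)
  have h2 : liminf (fun m => eLpNorm (weighted α (F m)) p volume) atTop ≤ (fockConst n α p)⁻¹ :=
    (liminf_le_liminf (Eventually.of_forall hle)).trans (by rw [liminf_const])
  rw [fockNorm_eq hp0 hg, ← ENNReal.mul_inv_cancel h0 ht]
  gcongr
  exact this.trans h2

/-- Compactness of the `L¹` embedding under tightness. -/
lemma CarlesonTight.exists_subseq (hα : 0 < α) (hp : 1 ≤ p) (ht : CarlesonTight α μ p)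
    (hfin : ∀ R : ℝ, μ (Metric.ball 0 R) < ⊤) {F : ℕ → Cn n → ℂ} (hF : ∀ m, MemFock α p (F m))
    (hF1 : ∀ m, fockNorm α p (F m) ≤ 1) :
    ∃ φ : ℕ → ℕ, StrictMono φ ∧ ∃ g : Cn n → ℂ, MemFock α p g ∧ fockNorm α p g ≤ 1 ∧
      Tendsto (fun m => ∫⁻ w, ‖weighted α (fun z => F (φ m) z - g z) w‖ₑ ∂μ) atTop (𝓝 0) := by
  obtain ⟨A, -, hA⟩ := exists_enorm_weighted_le_fockNorm n α hα hp
  have hFA : ∀ m z, ‖weighted α (F m) z‖ₑ ≤ A := fun m z =>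
    (hA _ (hF m).1 z).trans (mul_le_of_le_one_right' (hF1 m))
  obtain ⟨φ, hφ, g, hgd, hgA, hlim⟩ := exists_subseq_tendsto hα (fun m => (hF m).1) hFA
  have hg1 := fockNorm_le_one_of_tendsto hα hp (fun m => (hF (φ m)).1.continuous)
    (fun m => hF1 _) hgd.continuous hlim
  have hgm : MemFock α p g := ⟨hgd, hg1.trans_lt ENNReal.one_lt_top⟩
  refine ⟨φ, hφ, g, hgm, hg1, ?_⟩
  set h : ℕ → Cn n → ℂ := fun m z => F (φ m) z - g z with hh
  have hhm : ∀ m, MemFock α p (h m) := fun m => (hF _).sub hp hgm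
  have hmeas : ∀ m, Measurable fun w => ‖weighted α (h m) w‖ₑ := fun m =>
    (continuous_weighted (hhm m).1.continuous).enorm.measurable
  have hh2 : ∀ m, fockNorm α p (h m) ≤ 2 := fun m =>
    (fockNorm_sub_le hp (hF _).1.continuous hgd.continuous).trans
      ((add_le_add (hF1 _) hg1).trans (by norm_num))
  -- On a ball of finite measure the weighted differences are bounded by $2A$, so pointwise
  -- convergence suffices.
  have hhead : ∀ R : ℝ, Tendsto (fun m => ∫⁻ w in Metric.ball 0 R, ‖weighted α (h m) w‖ₑ ∂μ)
      atTop (𝓝 0) := fun R => by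
    have := tendsto_lintegral_of_dominated_convergence (μ := μ.restrict (Metric.ball 0 R))
      (F := fun m w => ‖weighted α (h m) w‖ₑ) (f := fun _ => 0) (fun _ => (A : ℝ≥0∞) + A) hmeas
      (fun m => Eventually.of_forall fun w => ?_) ?_ (Eventually.of_forall fun w => ?_)
    · simpa using this
    · simp only [hh]
      rw [weighted_sub, Pi.sub_apply]
      exact enorm_sub_le.trans (add_le_add (hFA _ w) (hgA w))
    · rw [lintegral_const, Measure.restrict_apply_univ]
      exact (ENNReal.mul_lt_top (by simp) (hfin R)).ne
    · have h0 : Tendsto (fun m => h m w) atTop (𝓝 0) := by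
        simpa [hh] using (hlim w).sub_const (g w)
      simpa [weighted] using (h0.mul_const _).enorm
  rw [ENNReal.tendsto_nhds_zero]
  intro ε hε
  obtain ⟨d, hd0, hdε⟩ := ENNReal.lt_iff_exists_nnreal_btwn.1 hε
  have hd0' : 0 < d := by exact_mod_cast hd0
  -- The differences have norm at most 2, so $d/4$ gives a tail of at most $d/2$.
  obtain ⟨R, hR⟩ := ht (d / 4) (by positivity)
  have hev := (ENNReal.tendsto_nhds_zero.1 (hhead R)) (d / 2 : ℝ≥0) (by
    exact_mod_cast (by positivity : 0 < d / 2))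
  filter_upwards [hev] with m hm
  rw [← lintegral_add_compl _ Metric.isOpen_ball.measurableSet (A := Metric.ball (0 : Cn n) R)]
  refine (add_le_add hm ((hR _ (hhm m)).trans (mul_le_mul_right (hh2 m) _))).trans
    (le_trans (le_of_eq ?_) hdε.le)
  have : (2 : ℝ≥0∞) = ((2 : ℝ≥0) : ℝ≥0∞) := by norm_num
  rw [this, ← ENNReal.coe_mul, ← ENNReal.coe_add]
  congr 1
  field_simp
  norm_num

lemma BallVanishing.ballSup_lt_top (hα : 0 < α) (hμ : Admissible α μ) (hv : BallVanishing μ) :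
    ballSup μ < ⊤ := by
  obtain ⟨R, hR⟩ := hv 1 one_pos
  refine lt_of_le_of_lt (iSup_le fun a => ?_)
    (ENNReal.add_lt_top.2 ⟨ENNReal.one_lt_top, hμ.measure_ball_lt_top hα 0 (R + 1)⟩)
  rcases le_or_gt R ‖a‖ with h | h
  · exact (hR a h).trans (by simp)
  · refine le_trans (measure_mono (Metric.ball_subset_ball' ?_)) le_add_self
    rw [dist_zero_right]; linarith

/-- The Carleson bound is applied to $\mu$ restricted to the complement of $D(0,R+1)$: unit balls
centred within $R$ lose all their mass, the others are small already. -/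
lemma BallVanishing.carlesonTight (hα : 0 < α) [SFinite μ] (hv : BallVanishing μ) :
    CarlesonTight α μ 1 := by
  obtain ⟨C, hC, h⟩ := exists_lintegral_weighted_le_ballSup n α hα
  intro ε hε
  obtain ⟨R, hR⟩ := hv (ε / C) (by positivity)
  refine ⟨R + 1, fun f hf => (h _ inferInstance f hf.1).trans ?_⟩
  gcongr
  have : ballSup (μ.restrict (Metric.ball 0 (R + 1))ᶜ) ≤ (ε / C : ℝ≥0) := iSup_le fun a => by
    rcases le_or_gt R ‖a‖ with h | h
    · exact (Measure.restrict_apply_le _ _).trans (hR a h)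
    · have hsub : Metric.ball a 1 ⊆ Metric.ball 0 (R + 1) := Metric.ball_subset_ball' (by
        rw [dist_zero_right]; linarith)
      rw [Measure.restrict_apply Metric.isOpen_ball.measurableSet,
        Set.disjoint_iff_inter_eq_empty.1 (Set.disjoint_compl_right_iff_subset.2 hsub)]
      simp
  refine (mul_le_mul_right this _).trans (le_of_eq ?_)
  rw [← ENNReal.coe_mul]
  congr 1
  field_simp

/-- The same restriction argument: removing a large ball kills finitely many chosen terms of a
convergent sum, and only its small tail remains. The sum of the $|z_j|+r$ is a radius containing all
the chosen balls. -/
lemma carlesonTight_of_tsum_lt_top (hα : 0 < α) (hp : 1 < p) {ι : Type*} [Countable ι] {δ r : ℝ}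
    (hδ : 0 < δ) (hr : 0 ≤ r) {z : ι → Cn n} (hz : BallSeparated δ z)
    (hcov : (⋃ j, Metric.ball (z j) r) = Set.univ)
    (hS : ∑' j, μ (Metric.ball (z j) r) ^ (ENNReal.conjExponent p).toReal < ⊤) :
    CarlesonTight α μ p := by
  obtain ⟨C, hC, h⟩ := exists_lintegral_weighted_le_tsum n α hα hδ r hp
  set q := (ENNReal.conjExponent p).toReal with hq
  have hq0 : 0 < q := one_pos.trans_le (conjExponent_toReal_ge_one hp)
  intro ε hε
  set η : ℝ≥0 := (ε / C) ^ q with hη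
  have hη0 : 0 < η := NNReal.rpow_pos (by positivity)
  obtain ⟨s, hs⟩ := ((ENNReal.tendsto_nhds_zero.1 (ENNReal.tendsto_tsum_compl_atTop_zero hS.ne)) η
    (by exact_mod_cast hη0)).exists
  set R : ℝ := ∑ j ∈ s, (‖z j‖ + r) with hR
  refine ⟨R, fun f hf => (h _ z hz hcov f hf.1).trans ?_⟩
  gcongr
  have hsum : ∑' j, μ.restrict (Metric.ball 0 R)ᶜ (Metric.ball (z j) r) ^ q ≤ η := by
    refine le_trans ?_ hs
    have h2 : ∑' j : {x // x ∉ s}, μ (Metric.ball (z j) r) ^ q =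
        ∑' j, ({x | x ∉ s} : Set ι).indicator (fun j => μ (Metric.ball (z j) r) ^ q) j :=
      tsum_subtype {x | x ∉ s} fun j => μ (Metric.ball (z j) r) ^ q
    rw [h2]
    refine ENNReal.tsum_le_tsum fun j => ?_
    by_cases hj : j ∈ s
    · have hsub : Metric.ball (z j) r ⊆ Metric.ball 0 R := Metric.ball_subset_ball' (by
        rw [dist_zero_right, add_comm]
        exact Finset.single_le_sum (f := fun j => ‖z j‖ + r) (fun _ _ => by positivity) hj)
      rw [Measure.restrict_apply Metric.isOpen_ball.measurableSet,
        Set.disjoint_iff_inter_eq_empty.1 (Set.disjoint_compl_right_iff_subset.2 hsub),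
        measure_empty, ENNReal.zero_rpow_of_pos hq0]
      exact zero_le
    · rw [Set.indicator_of_mem (by exact hj)]
      exact ENNReal.rpow_le_rpow (Measure.restrict_apply_le _ _) hq0.le
  calc (C : ℝ≥0∞) * (∑' j, μ.restrict (Metric.ball 0 R)ᶜ (Metric.ball (z j) r) ^ q) ^ (1 / q)
      ≤ C * (η : ℝ≥0∞) ^ (1 / q) := by gcongr
    _ = ε := by
        rw [hη, ENNReal.coe_rpow_of_nonneg _ hq0.le, one_div, ENNReal.rpow_rpow_inv hq0.ne',
          ← ENNReal.coe_mul]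
        congr 1
        field_simp

/-- A subsequence converges in $L^1(\sigma_1)$ to a member of the domain, and $T_\mu$ is continuous
from that norm to $\mathcal F^s$. -/
lemma toeplitzCompact_of_carlesonTight (hα : 0 < α) (hp : 1 ≤ p) {s : ℝ≥0∞} (hs : 1 ≤ s)
    (hμ : Admissible α μ) (hemb : embeddingNorm α μ p 1 < ⊤) (ht : CarlesonTight α μ p) :
    ToeplitzCompact α μ p s := by
  have := hμ.isLocallyFiniteMeasure hα
  obtain ⟨C, -, hC⟩ := exists_toeplitzNorm_le_embeddingNorm n α hα hp hs
  obtain ⟨D, -, hD⟩ := exists_fockNorm_toeplitz_le n α hα hs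
  have hs0 : s ≠ 0 := (one_pos.trans_le hs).ne'
  have hbdd : ToeplitzBounded α μ p s := (toeplitzBounded_iff hα hp hs0).2
    ((hC μ inferInstance).trans_lt (ENNReal.mul_lt_top ENNReal.coe_lt_top hemb))
  refine ⟨hbdd, fun F hF => ?_⟩
  obtain ⟨φ, hφ, g, hg, hg1, hlim⟩ := ht.exists_subseq hα hp
    (fun R => hμ.measure_ball_lt_top hα 0 R) (fun m => (hF m).1.1) fun m => (hF m).2
  have hgdom : InToeplitzDomain α μ p g := .of_lintegral_lt_top hα hg
    ((lintegral_weighted_le_embeddingNorm hα hp hg).trans_lt (ENNReal.mul_lt_top hemb hg.2))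
  obtain ⟨B, hB⟩ := hbdd
  refine ⟨φ, hφ, toeplitz α μ g, (hB g hgdom).1, ?_⟩
  have hlim' := ENNReal.Tendsto.const_mul (a := (D : ℝ≥0∞)) hlim (Or.inr ENNReal.coe_ne_top)
  rw [mul_zero] at hlim'
  refine tendsto_of_tendsto_of_tendsto_of_le_of_le tendsto_const_nhds hlim'
    (fun m => zero_le) fun m => ?_
  have := hD μ inferInstance p _ ((hF (φ m)).1.sub hp hgdom)
  rwa [toeplitz_sub (hF (φ m)).1 hgdom] at this

lemma isVanishingFockCarleson_of_carlesonTight (hα : 0 < α) {q : ℝ} (hq : 1 ≤ q)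
    (hμ : Admissible α μ) (hemb : embeddingNorm α μ 1 q < ⊤) (ht : CarlesonTight α μ 1) :
    IsVanishingFockCarleson α μ 1 q := by
  have hq0 : 0 < q := by linarith
  refine ⟨(isFockCarleson_iff hα le_rfl hq0).2 hemb, fun F hF => ?_⟩
  obtain ⟨A, -, hA⟩ := exists_enorm_weighted_le_fockNorm n α hα (le_refl 1)
  obtain ⟨φ, hφ, g, hg, hg1, hlim⟩ := ht.exists_subseq hα le_rfl
    (fun R => hμ.measure_ball_lt_top hα 0 R) (fun m => (hF m).1) fun m => (hF m).2
  refine ⟨φ, hφ, g, ⟨hg.1.continuous.aestronglyMeasurable, ?_⟩, ?_⟩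
  · rw [eLpNorm_sigmaMeasure μ hq0]
    exact (eLpNorm_weighted_le_embeddingNorm hα le_rfl hq0 hg).trans_lt
      (ENNReal.mul_lt_top hemb hg.2)
  have hh : ∀ m, MemFock α 1 fun z => F (φ m) z - g z := fun m => (hF _).1.sub le_rfl hg
  have hh2 : ∀ m, fockNorm α 1 (fun z => F (φ m) z - g z) ≤ 2 := fun m =>
    (fockNorm_sub_le le_rfl (hF _).1.1.continuous hg.1.continuous).trans
      ((add_le_add (hF _).2 hg1).trans (by norm_num))
  have hK : ((A : ℝ≥0∞) * 2) ^ (q - 1) ≠ ⊤ :=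
    ENNReal.rpow_ne_top_of_nonneg (by linarith) (ENNReal.mul_ne_top ENNReal.coe_ne_top (by simp))
  have hlim' := (ENNReal.Tendsto.const_mul (a := ((A : ℝ≥0∞) * 2) ^ (q - 1)) hlim
    (Or.inr hK)).ennrpow_const q⁻¹
  rw [mul_zero, ENNReal.zero_rpow_of_pos (inv_pos.2 hq0)] at hlim'
  refine tendsto_of_tendsto_of_tendsto_of_le_of_le tendsto_const_nhds hlim'
    (fun m => zero_le) fun m => ?_
  rw [ENNReal.le_rpow_inv_iff hq0, eLpNorm_sigmaMeasure μ hq0, eLpNorm_weighted_rpow hq0]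
  exact lintegral_enorm_rpow_le hq
    (continuous_weighted (hh m).1.continuous).enorm.measurable.aemeasurable
    fun z => (hA _ (hh m).1 z).trans (mul_le_mul_right (hh2 m) _)

lemma tendsto_gauss_sub {c : ℝ} (hc : 0 < c) {a : ℕ → Cn n}
    (ha : Tendsto (fun m => ‖a m‖) atTop atTop) (w : Cn n) :
    Tendsto (fun m => gauss c (w - a m)) atTop (𝓝 0) := by
  have h1 : Tendsto (fun m => ‖w - a m‖) atTop atTop := by
    refine tendsto_atTop_mono (fun m => ?_) (tendsto_atTop_add_const_right _ (-‖w‖) ha)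
    have := norm_sub_norm_le (a m) w
    rw [norm_sub_rev] at this
    linarith
  have h2 : Tendsto (fun m => Real.exp (-c * ‖w - a m‖ ^ 2)) atTop (𝓝 0) := by
    refine Real.tendsto_exp_atBot.comp ?_
    exact ((tendsto_pow_atTop two_ne_zero).comp h1).const_mul_atTop_of_neg (by linarith)
  simpa [gauss] using ENNReal.tendsto_ofReal h2

lemma exists_seq_of_not_ballVanishing (h : ¬ BallVanishing μ) :
    ∃ ε : ℝ≥0, 0 < ε ∧ ∃ a : ℕ → Cn n, Tendsto (fun m => ‖a m‖) atTop atTop ∧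
      ∀ m, (ε : ℝ≥0∞) ≤ μ (Metric.ball (a m) 1) := by
  unfold BallVanishing at h
  push Not at h
  obtain ⟨ε, hε, h⟩ := h
  choose a ha hlt using fun m : ℕ => h m
  exact ⟨ε, hε, a, tendsto_atTop_mono ha tendsto_natCast_atTop_atTop, fun m => (hlt m).le⟩

/-- If unit balls of mass at least $\varepsilon$ escape to infinity, the kernels at their centres
tend to 0 pointwise. Fatou forces any $L^q$ limit to be 0, while their norms stay bounded below. -/
lemma IsVanishingFockCarleson.ballVanishing (hα : 0 < α) {q : ℝ} (hq : 1 ≤ q)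
    (hv : IsVanishingFockCarleson α μ 1 q) : BallVanishing μ := by
  have hq0 : 0 < q := by linarith
  by_contra hcon
  obtain ⟨ε, hε, a, ha, hle⟩ := exists_seq_of_not_ballVanishing hcon
  obtain ⟨φ, hφ, g, hg, hlim⟩ := hv.2 (fun m => normKernel α (a m)) fun m =>
    ⟨memFock_normKernel hα one_ne_zero _, (fockNorm_normKernel hα one_ne_zero _).le⟩
  have hk0 : ∀ w, Tendsto (fun m => normKernel α (a (φ m)) w) atTop (𝓝 0) := fun w => by
    have h1 := tendsto_gauss_sub (c := α / 2) (by positivity)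
      (ha.comp hφ.tendsto_atTop) w
    have h2 : Tendsto (fun m => ‖normKernel α (a (φ m)) w‖ₑ * gauss (α / 2) w *
        (gauss (α / 2) w)⁻¹) atTop (𝓝 (0 * (gauss (α / 2) w)⁻¹)) := by
      refine ENNReal.Tendsto.mul_const ?_ (Or.inr (ENNReal.inv_ne_top.2 (gauss_pos _ _).ne'))
      simpa only [← enorm_weighted_normKernel, enorm_weighted] using h1
    simp only [mul_assoc, ENNReal.mul_inv_cancel (gauss_pos (α / 2) w).ne' (gauss_ne_top _ _),
      mul_one, zero_mul] at h2
    rwa [tendsto_zero_iff_enorm_tendsto_zero]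
  set σ := sigmaMeasure α μ q with hσ
  have hkm : ∀ m, AEStronglyMeasurable (normKernel α (a (φ m))) σ := fun m =>
    (differentiable_normKernel _).continuous.aestronglyMeasurable
  have hg0 : eLpNorm g (ENNReal.ofReal q) σ = 0 := by
    have h1 := Lp.eLpNorm_lim_le_liminf_eLpNorm (p := ENNReal.ofReal q) (μ := σ)
      (f := fun m z => normKernel α (a (φ m)) z - g z) (fun m => (hkm m).sub hg.1) (-g)
      (Eventually.of_forall fun w => by simpa using (hk0 w).sub_const (g w))
    rw [hlim.liminf_eq, eLpNorm_neg] at h1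
    exact le_antisymm h1 zero_le
  have hk : Tendsto (fun m => eLpNorm (normKernel α (a (φ m))) (ENNReal.ofReal q) σ) atTop
      (𝓝 0) := by
    refine tendsto_of_tendsto_of_tendsto_of_le_of_le tendsto_const_nhds hlim
      (fun m => zero_le) fun m => ?_
    have h1 := eLpNorm_add_le (p := ENNReal.ofReal q) ((hkm m).sub hg.1) hg.1
      (by rwa [ENNReal.one_le_ofReal])
    rw [sub_add_cancel, hg0, add_zero] at h1
    exact h1
  have hk' := ENNReal.Tendsto.const_mul (a := ENNReal.ofReal (Real.exp (α / 2 * q)))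
    (hk.ennrpow_const q) (Or.inr ENNReal.ofReal_ne_top)
  rw [ENNReal.zero_rpow_of_pos hq0, mul_zero] at hk'
  have hge : (ε : ℝ≥0∞) ≤ 0 := ge_of_tendsto' hk' fun m => by
    rw [eLpNorm_sigmaMeasure μ hq0, eLpNorm_weighted_rpow hq0]
    exact (hle _).trans (measure_ball_le_lintegral_normKernel μ hα hq0 _)
  exact absurd hge (not_le.2 (by exact_mod_cast hε))

/-- As for the embedding, escaping kernels have images tending to 0 pointwise, so a norm limit is 0;
but the norm of $T_\mu k_a$ dominates $\mu(D(a,1))$. -/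
lemma ToeplitzCompact.ballVanishing (hα : 0 < α) {s : ℝ≥0∞} (hs : 1 ≤ s) (hμ : Admissible α μ)
    (hemb : embeddingNorm α μ 1 1 < ⊤) (hc : ToeplitzCompact α μ 1 s) : BallVanishing μ := by
  have hs0 : s ≠ 0 := (one_pos.trans_le hs).ne'
  by_contra hcon
  obtain ⟨ε, hε, a, ha, hle⟩ := exists_seq_of_not_ballVanishing hcon
  have hdom : ∀ b : Cn n, InToeplitzDomain α μ 1 (normKernel α b) := fun b =>
    hμ.inToeplitzDomain_normKernel hα one_ne_zero b
  obtain ⟨φ, hφ, g, hg, hlim⟩ := hc.2 (fun m => normKernel α (a m)) fun m =>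
    ⟨hdom _, (fockNorm_normKernel hα one_ne_zero _).le⟩
  obtain ⟨A, -, hA⟩ := exists_enorm_weighted_le_fockNorm n α hα hs
  have hTd : ∀ m, Differentiable ℂ (toeplitz α μ (normKernel α (a (φ m)))) := fun m =>
    (hdom _).differentiable hα
  have hpt : ∀ u, Tendsto (fun m => ‖weighted α (toeplitz α μ (normKernel α (a (φ m)))) u‖ₑ)
      atTop (𝓝 0) := fun u => by
    -- The majorant for dominated convergence is the weighted modulus of $k_u$, integrable because
    -- the embedding is bounded.
    have hbound : ∫⁻ w, gauss (α / 2) (w - u) ∂μ ≠ ⊤ := by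
      have := lintegral_weighted_le_embeddingNorm (μ := μ) hα le_rfl
        (memFock_normKernel hα one_ne_zero u)
      simp only [enorm_weighted_normKernel] at this
      exact (this.trans_lt (ENNReal.mul_lt_top hemb
        (memFock_normKernel hα one_ne_zero u).2)).ne
    have hdct := tendsto_lintegral_of_dominated_convergence (μ := μ)
      (F := fun m w => ‖weighted α (normKernel α (a (φ m))) w‖ₑ * gauss (α / 2) (u - w))
      (f := fun _ => 0) (fun w => gauss (α / 2) (w - u)) (fun m => ?_)
      (fun m => Eventually.of_forall fun w => ?_) hbound (Eventually.of_forall fun w => ?_)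
    · rw [lintegral_zero] at hdct
      exact tendsto_of_tendsto_of_tendsto_of_le_of_le tendsto_const_nhds hdct
        (fun m => zero_le) fun m => enorm_weighted_toeplitz_le u
    · exact (continuous_weighted
        (differentiable_normKernel _).continuous).enorm.measurable.mul (by fun_prop)
    · simp only [enorm_weighted_normKernel]
      rw [gauss_sub_comm _ u w]
      exact mul_le_of_le_one_left' (gauss_le_one (by positivity) _)
    · simp only [enorm_weighted_normKernel]
      have := ENNReal.Tendsto.mul_const (b := gauss (α / 2) (u - w))
        (tendsto_gauss_sub (c := α / 2) (by positivity) (ha.comp hφ.tendsto_atTop) w)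
        (Or.inr (gauss_ne_top _ _))
      rwa [zero_mul] at this
  have hg0 : g = 0 := by
    ext u
    have h1 := (ENNReal.Tendsto.const_mul (a := (A : ℝ≥0∞)) hlim
      (Or.inr ENNReal.coe_ne_top)).add (hpt u)
    rw [mul_zero, add_zero] at h1
    have h2 : ‖weighted α g u‖ₑ ≤ 0 := ge_of_tendsto' h1 fun m => by
      have h3 := hA _ ((hTd m).sub hg.1) u
      have h4 : weighted α g u = weighted α (toeplitz α μ (normKernel α (a (φ m)))) u -
          weighted α (fun z => toeplitz α μ (normKernel α (a (φ m))) z - g z) u := by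
        rw [weighted_sub, Pi.sub_apply, sub_sub_cancel]
      rw [h4, add_comm]
      exact enorm_sub_le.trans (add_le_add le_rfl h3)
    rw [nonpos_iff_eq_zero, enorm_weighted, mul_eq_zero] at h2
    simpa using h2.resolve_right (gauss_pos _ _).ne'
  obtain ⟨C, -, hC⟩ := exists_measure_ball_le_fockNorm_toeplitz n α hα hs
  have hlim' := ENNReal.Tendsto.const_mul (a := (C : ℝ≥0∞)) hlim (Or.inr ENNReal.coe_ne_top)
  simp only [hg0, Pi.zero_apply, sub_zero, mul_zero] at hlim'
  have hge : (ε : ℝ≥0∞) ≤ 0 := ge_of_tendsto' hlim' fun m => (hle _).trans (hC μ hμ _)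
  exact absurd hge (not_le.2 (by exact_mod_cast hε))

end Compactness

-- Assembling the equivalences and norm comparisons

section Equivalences

variable {n : ℕ} {α : ℝ} {p : ℝ≥0∞} {μ : Measure (Cn n)}

lemma admissibleEquiv_of_le {U V : Measure (Cn n) → ℝ≥0∞} {C D : ℝ≥0}
    (h1 : ∀ μ, Admissible α μ → U μ ≤ C * V μ) (h2 : ∀ μ, Admissible α μ → V μ ≤ D * U μ) :
    AdmissibleEquiv α U V := by
  refine ⟨max C D, fun μ hμ => ⟨(h1 μ hμ).trans ?_, (h2 μ hμ).trans ?_⟩⟩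
  · gcongr; exact le_max_left _ _
  · gcongr; exact le_max_right _ _

lemma exists_carlesonExponent (p : ℝ≥0∞) : ∃ q, CarlesonExponent p q :=
  -- For $p=\infty$ the value `p.toReal` is 0, and the exponent is 1.
  ⟨max 1 p.toReal, le_max_left _ _, fun hp => by
    rw [← ENNReal.ofReal_toReal hp]
    exact ENNReal.ofReal_le_ofReal (by simp)⟩

lemma isFockCarleson_one_iff_ballSup (hα : 0 < α) [SFinite μ] {q : ℝ} (hq : 1 ≤ q) :
    IsFockCarleson α μ 1 q ↔ ballSup μ < ⊤ := by
  have hq0 : 0 < q := by linarith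
  rw [isFockCarleson_iff hα le_rfl hq0, ← ENNReal.rpow_lt_top_iff_of_pos hq0]
  obtain ⟨C, -, hC⟩ := exists_embeddingNorm_rpow_le_ballSup n α hα hq
  obtain ⟨D, -, hD⟩ := exists_ballSup_le_embeddingNorm_rpow n α hα hq0
  exact ⟨fun h => (hD μ).trans_lt (ENNReal.mul_lt_top ENNReal.coe_lt_top h),
    fun h => (hC μ inferInstance).trans_lt (ENNReal.mul_lt_top ENNReal.coe_lt_top h)⟩

lemma embeddingNorm_one_lt_top_iff_ballSup (hα : 0 < α) [SFinite μ] :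
    embeddingNorm α μ 1 1 < ⊤ ↔ ballSup μ < ⊤ := by
  rw [← isFockCarleson_iff hα le_rfl one_pos, isFockCarleson_one_iff_ballSup hα le_rfl]

lemma toeplitzBounded_one_iff_ballSup (hα : 0 < α) (hμ : Admissible α μ) (hp : 1 ≤ p) :
    ToeplitzBounded α μ 1 p ↔ ballSup μ < ⊤ := by
  have := hμ.isLocallyFiniteMeasure hα
  rw [toeplitzBounded_iff hα le_rfl (one_pos.trans_le hp).ne']
  obtain ⟨C, -, hC⟩ := exists_ballSup_le_toeplitzNorm n α hα hp
  obtain ⟨D, -, hD⟩ := exists_toeplitzNorm_le_embeddingNorm n α hα le_rfl hp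
  exact ⟨fun h => (hC μ hμ).trans_lt (ENNReal.mul_lt_top ENNReal.coe_lt_top h),
    fun h => (hD μ inferInstance).trans_lt (ENNReal.mul_lt_top ENNReal.coe_lt_top
      ((embeddingNorm_one_lt_top_iff_ballSup hα).2 h))⟩

lemma isVanishingFockCarleson_one_iff_ballVanishing (hα : 0 < α) (hμ : Admissible α μ) {q : ℝ}
    (hq : 1 ≤ q) : IsVanishingFockCarleson α μ 1 q ↔ BallVanishing μ := by
  have := hμ.isLocallyFiniteMeasure hα
  refine ⟨fun h => h.ballVanishing hα hq, fun h => ?_⟩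
  exact isVanishingFockCarleson_of_carlesonTight hα hq hμ
    ((isFockCarleson_iff hα le_rfl (by linarith)).1
      ((isFockCarleson_one_iff_ballSup hα hq).2 (h.ballSup_lt_top hα hμ))) (h.carlesonTight hα)

lemma toeplitzCompact_one_iff_ballVanishing (hα : 0 < α) (hμ : Admissible α μ) (hp : 1 ≤ p) :
    ToeplitzCompact α μ 1 p ↔ BallVanishing μ := by
  have := hμ.isLocallyFiniteMeasure hα
  refine ⟨fun h => h.ballVanishing hα hp hμ ?_, fun h => ?_⟩
  · exact (embeddingNorm_one_lt_top_iff_ballSup hα).2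
      ((toeplitzBounded_one_iff_ballSup hα hμ hp).1 h.1)
  · exact toeplitzCompact_of_carlesonTight hα le_rfl hp hμ
      ((embeddingNorm_one_lt_top_iff_ballSup hα).2 (h.ballSup_lt_top hα hμ)) (h.carlesonTight hα)

lemma memFock_inToeplitzDomain (hα : 0 < α) (hp : 1 ≤ p) (hemb : embeddingNorm α μ p 1 < ⊤)
    {f : Cn n → ℂ} (hf : MemFock α p f) : InToeplitzDomain α μ p f :=
  .of_lintegral_lt_top hα hf ((lintegral_weighted_le_embeddingNorm hα hp hf).trans_lt
    (ENNReal.mul_lt_top hemb hf.2))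

lemma exists_embeddingNorm_rpow_le_toeplitzNorm (n : ℕ) (α : ℝ) (hα : 0 < α) (hp : 1 ≤ p) {q : ℝ}
    (hq : 1 ≤ q) : ∃ C : ℝ≥0, ∀ μ : Measure (Cn n), Admissible α μ →
      embeddingNorm α μ 1 q ^ q ≤ C * toeplitzNorm α μ 1 p := by
  obtain ⟨C, -, hC⟩ := exists_embeddingNorm_rpow_le_ballSup n α hα hq
  obtain ⟨D, -, hD⟩ := exists_ballSup_le_toeplitzNorm n α hα hp
  refine ⟨C * D, fun μ hμ => ?_⟩
  have := hμ.isLocallyFiniteMeasure hα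
  refine (hC μ inferInstance).trans ?_
  rw [ENNReal.coe_mul, mul_assoc]
  gcongr
  exact hD μ hμ

/-- The passage from exponent 1 to exponent $q$ goes through the supremum of ball masses, to which
both embedding quantities are comparable. -/
lemma exists_toeplitzNorm_le_embeddingNorm_rpow (n : ℕ) (α : ℝ) (hα : 0 < α) (hp : 1 ≤ p) {q : ℝ}
    (hq : 1 ≤ q) : ∃ C : ℝ≥0, ∀ μ : Measure (Cn n), Admissible α μ →
      toeplitzNorm α μ 1 p ≤ C * embeddingNorm α μ 1 q ^ q := by
  obtain ⟨C, -, hC⟩ := exists_toeplitzNorm_le_embeddingNorm n α hα le_rfl hp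
  obtain ⟨D, -, hD⟩ := exists_embeddingNorm_rpow_le_ballSup n α hα le_rfl
  obtain ⟨E, -, hE⟩ := exists_ballSup_le_embeddingNorm_rpow n α hα (q := q) (by linarith)
  refine ⟨C * (D * E), fun μ hμ => ?_⟩
  have := hμ.isLocallyFiniteMeasure hα
  refine (hC μ inferInstance).trans ?_
  have hD' := hD μ inferInstance
  rw [ENNReal.rpow_one] at hD'
  rw [ENNReal.coe_mul, ENNReal.coe_mul, mul_assoc, mul_assoc]
  gcongr
  refine hD'.trans ?_
  gcongr
  exact hE μ

lemma embeddingNorm_lt_top_of_tsum_lt_top (hα : 0 < α) (hp : 1 < p) {ι : Type*} [Countable ι]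
    {δ r : ℝ} (hδ : 0 < δ) {z : ι → Cn n} (hz : BallSeparated δ z)
    (hcov : (⋃ j, Metric.ball (z j) r) = Set.univ)
    (hS : ∑' j, μ (Metric.ball (z j) r) ^ (ENNReal.conjExponent p).toReal < ⊤) :
    embeddingNorm α μ p 1 < ⊤ := by
  obtain ⟨C, -, h⟩ := exists_lintegral_weighted_le_tsum n α hα hδ r hp
  have hq0 := one_pos.trans_le (conjExponent_toReal_ge_one hp)
  have := embeddingNorm_rpow_le (α := α) (p := p) (μ := μ) one_pos
    (S := C * (∑' j, μ (Metric.ball (z j) r) ^ (ENNReal.conjExponent p).toReal) ^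
          (1 / (ENNReal.conjExponent p).toReal)) fun f hf h1 => by
    simp only [ENNReal.rpow_one]
    exact (h μ z hz hcov f hf.1).trans (mul_le_of_le_one_right' h1)
  rw [ENNReal.rpow_one] at this
  exact this.trans_lt (ENNReal.mul_lt_top ENNReal.coe_lt_top
    (ENNReal.rpow_lt_top_of_nonneg (by positivity) hS.ne))

/-- One fixed lattice, chosen before $\mu$, serves all measures and keeps the constant uniform. -/
lemma exists_embeddingNorm_le_toeplitzNorm (n : ℕ) (α : ℝ) (hα : 0 < α) (hp : 1 < p) :
    ∃ C : ℝ≥0, ∀ μ : Measure (Cn n), Admissible α μ →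
      embeddingNorm α μ p 1 ≤ C * toeplitzNorm α μ p 1 := by
  obtain ⟨z, hz, hcov⟩ := exists_ballSeparated_cover n
  obtain ⟨C, -, hC⟩ := exists_lintegral_weighted_le_tsum n α hα (δ := 1 / 2) (by norm_num)
    (n + 1) hp
  obtain ⟨D, hD⟩ := exists_tsum_measure_ball_le n α hα (δ := 1 / 2) (by norm_num) (n + 1) hp
  have hq0 := one_pos.trans_le (conjExponent_toReal_ge_one hp)
  refine ⟨C * D, fun μ hμ => ?_⟩
  have := embeddingNorm_rpow_le (α := α) (p := p) (μ := μ) one_pos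
    (S := C * (D * toeplitzNorm α μ p 1)) fun f hf h1 => by
    simp only [ENNReal.rpow_one]
    refine (hC μ z hz hcov f hf.1).trans ((mul_le_of_le_one_right' h1).trans ?_)
    gcongr
    rw [one_div, ENNReal.rpow_inv_le_iff hq0]
    exact hD μ hμ z hz
  rwa [ENNReal.rpow_one, ← mul_assoc, ← ENNReal.coe_mul] at this

lemma toeplitzNorm_lt_top_iff_embeddingNorm (hα : 0 < α) (hμ : Admissible α μ) (hp : 1 < p) :
    toeplitzNorm α μ p 1 < ⊤ ↔ embeddingNorm α μ p 1 < ⊤ := by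
  have := hμ.isLocallyFiniteMeasure hα
  obtain ⟨C, -, hC⟩ := exists_toeplitzNorm_le_embeddingNorm n α hα hp.le le_rfl
  obtain ⟨D, hD⟩ := exists_embeddingNorm_le_toeplitzNorm n α hα hp
  exact ⟨fun h => (hD μ hμ).trans_lt (ENNReal.mul_lt_top ENNReal.coe_lt_top h),
    fun h => (hC μ inferInstance).trans_lt (ENNReal.mul_lt_top ENNReal.coe_lt_top h)⟩

lemma tsum_measure_ball_lt_top (hα : 0 < α) (hμ : Admissible α μ) (hp : 1 < p) {ι : Type*}
    {δ : ℝ} (hδ : 0 < δ) (r : ℝ) {z : ι → Cn n} (hz : BallSeparated δ z)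
    (h : toeplitzNorm α μ p 1 < ⊤) :
    ∑' j, μ (Metric.ball (z j) r) ^ (ENNReal.conjExponent p).toReal < ⊤ := by
  obtain ⟨C, hC⟩ := exists_tsum_measure_ball_le n α hα hδ r hp
  exact (hC μ hμ z hz).trans_lt (ENNReal.rpow_lt_top_of_nonneg ENNReal.toReal_nonneg
    (ENNReal.mul_lt_top ENNReal.coe_lt_top h).ne)

/-- Boundedness puts the lattice masses in $\ell^{p'}$ with $p'$ finite, and summability makes the
embedding tight. -/
lemma toeplitzCompact_of_toeplitzNorm_lt_top (hα : 0 < α) (hμ : Admissible α μ) (hp : 1 < p)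
    (h : toeplitzNorm α μ p 1 < ⊤) : ToeplitzCompact α μ p 1 := by
  obtain ⟨z, hz, hcov⟩ := exists_ballSeparated_cover n
  exact toeplitzCompact_of_carlesonTight hα hp.le le_rfl hμ
    ((toeplitzNorm_lt_top_iff_embeddingNorm hα hμ hp).1 h)
    (carlesonTight_of_tsum_lt_top hα hp (by norm_num) (by positivity) hz hcov
      (tsum_measure_ball_lt_top hα hμ hp (by norm_num) _ hz h))

end Equivalences

theorem theorem2p5 (n : ℕ) (hn : 1 ≤ n) (α : ℝ) (hα : 0 < α) :
    (∀ p : ℝ≥0∞, 1 ≤ p →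
      (∀ μ : Measure (Cn n), Admissible α μ →
        List.TFAE [
          ToeplitzBounded α μ 1 p,
          ∃ q : ℝ, CarlesonExponent p q ∧ IsFockCarleson α μ 1 q,
          ∀ q : ℝ, CarlesonExponent p q → IsFockCarleson α μ 1 q] ∧
        (ToeplitzBounded α μ 1 p → ∀ f : Cn n → ℂ, MemFock α 1 f → InToeplitzDomain α μ 1 f) ∧
        List.TFAE [
          ToeplitzCompact α μ 1 p,
          ∃ q : ℝ, CarlesonExponent p q ∧ IsVanishingFockCarleson α μ 1 q,
          ∀ q : ℝ, CarlesonExponent p q → IsVanishingFockCarleson α μ 1 q]) ∧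
      AdmissibleEquiv (n := n) α (fun μ => toeplitzNorm α μ 1 p)
        (fun μ => embeddingNorm α μ 1 1) ∧
      (p ≠ ⊤ → AdmissibleEquiv (n := n) α (fun μ => toeplitzNorm α μ 1 p)
        (fun μ => embeddingNorm α μ 1 p.toReal ^ p.toReal))) ∧
    (∀ p : ℝ≥0∞, 1 < p →
      (∀ μ : Measure (Cn n), Admissible α μ →
        List.TFAE [
          ToeplitzBounded α μ p 1,
          ToeplitzCompact α μ p 1,
          IsFockCarleson α μ p 1] ∧
        (ToeplitzBounded α μ p 1 → ∀ f : Cn n → ℂ, MemFock α p f → InToeplitzDomain α μ p f) ∧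
        (∀ r : ℝ, 0 < r → ∀ z : ℕ → Cn n, IsHalfLattice r z →
          (IsFockCarleson α μ p 1 ↔
            ∑' j, μ (Metric.ball (z j) r) ^ (ENNReal.conjExponent p).toReal < ⊤))) ∧
      AdmissibleEquiv (n := n) α (fun μ => toeplitzNorm α μ p 1)
        (fun μ => embeddingNorm α μ p 1)) := by
  refine ⟨fun p hp => ⟨fun μ hμ => ?_, ?_, fun hpt => ?_⟩, fun p hp => ⟨fun μ hμ => ?_, ?_⟩⟩
  · have := hμ.isLocallyFiniteMeasure hα
    obtain ⟨q₀, hq₀⟩ := exists_carlesonExponent p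
    have hT := toeplitzBounded_one_iff_ballSup hα hμ hp
    have hV := toeplitzCompact_one_iff_ballVanishing hα hμ hp
    refine ⟨?_, fun h f hf => ?_, ?_⟩
    · tfae_have 1 → 3 := fun h q hq =>
        (isFockCarleson_one_iff_ballSup hα hq.1).2 (hT.1 h)
      tfae_have 3 → 2 := fun h => ⟨q₀, hq₀, h q₀ hq₀⟩
      tfae_have 2 → 1 := fun ⟨q, hq, h⟩ =>
        hT.2 ((isFockCarleson_one_iff_ballSup hα hq.1).1 h)
      tfae_finish
    · exact memFock_inToeplitzDomain hα le_rfl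
        ((embeddingNorm_one_lt_top_iff_ballSup hα).2 (hT.1 h)) hf
    · tfae_have 1 → 3 := fun h q hq =>
        (isVanishingFockCarleson_one_iff_ballVanishing hα hμ hq.1).2 (hV.1 h)
      tfae_have 3 → 2 := fun h => ⟨q₀, hq₀, h q₀ hq₀⟩
      tfae_have 2 → 1 := fun ⟨q, hq, h⟩ =>
        hV.2 ((isVanishingFockCarleson_one_iff_ballVanishing hα hμ hq.1).1 h)
      tfae_finish
  · obtain ⟨C, hC⟩ := exists_toeplitzNorm_le_embeddingNorm_rpow n α hα hp le_rfl
    obtain ⟨D, hD⟩ := exists_embeddingNorm_rpow_le_toeplitzNorm n α hα hp le_rfl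
    simp only [ENNReal.rpow_one] at hC hD
    exact admissibleEquiv_of_le hC hD
  · have hp1 : 1 ≤ p.toReal := by simpa using ENNReal.toReal_mono hpt hp
    obtain ⟨C, hC⟩ := exists_toeplitzNorm_le_embeddingNorm_rpow n α hα hp hp1
    obtain ⟨D, hD⟩ := exists_embeddingNorm_rpow_le_toeplitzNorm n α hα hp hp1
    exact admissibleEquiv_of_le hC hD
  · have hT := toeplitzBounded_iff (μ := μ) hα hp.le (s := 1) one_ne_zero
    have hE := toeplitzNorm_lt_top_iff_embeddingNorm hα hμ hp
    have hF := isFockCarleson_iff (μ := μ) hα hp.le one_pos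
    refine ⟨?_, fun h f hf => ?_, fun r hr z hz => ⟨fun h => ?_, fun h => ?_⟩⟩
    · tfae_have 1 → 2 := fun h => toeplitzCompact_of_toeplitzNorm_lt_top hα hμ hp (hT.1 h)
      tfae_have 2 → 1 := fun h => h.1
      tfae_have 1 ↔ 3 := hT.trans (hE.trans hF.symm)
      tfae_finish
    · exact memFock_inToeplitzDomain hα hp.le (hE.1 (hT.1 h)) hf
    · exact tsum_measure_ball_lt_top hα hμ hp (by positivity) r hz.2 (hE.2 (hF.1 h))
    -- The family is separated at radius $r/4$, and its balls of radius $r$ cover since those of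
    -- radius $r/2$ do.
    · refine hF.2 (embeddingNorm_lt_top_of_tsum_lt_top hα hp (δ := r / 4) (by positivity) hz.2
        (Set.eq_univ_of_univ_subset ?_) h)
      rw [← hz.1]
      exact Set.iUnion_mono fun j => Metric.ball_subset_ball (by linarith)
  · obtain ⟨C, -, hC⟩ := exists_toeplitzNorm_le_embeddingNorm n α hα hp.le le_rfl
    obtain ⟨D, hD⟩ := exists_embeddingNorm_le_toeplitzNorm n α hα hp
    refine admissibleEquiv_of_le (C := C) (fun μ hμ => ?_) hD
    have := hμ.isLocallyFiniteMeasure hα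
    exact hC μ inferInstance
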